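/- **Setting.** Let $\Gamma=(m_{i,j})_{i,j\in I}$ be a Coxeter matrix of type $A_m$ $(m\ge 1)$ or $D_m$ $(m\ge 4)$, with Artin–Tits group $B_\Gamma$ (standard generators $s_i$, $i\in I$), simple roots $\alpha_i$, set of positive roots $\Phi^+$, symmetric bilinear form $(\cdot\,|\,\cdot)$ normalized by $(\alpha_i|\alpha_i)=2$, and reflections $r_i$. Let $R$ be a commutative ring, let $b,c,d\in R^\times$, and put $a=d-bc/d$. Let $V$ be the free $R$-module with basis $(e_\alpha)_{\alpha\in\Phi^+}$, and for $i\in I$ let $\varphi_i\in\mathrm{End}_R(V)$ be given by $$\varphi_i(e_\alpha)=\begin{cases}0&\text{if }\alpha=\alpha_i,\\ d\,e_\alpha&\text{if }(\alpha|\alpha_i)=0,\\ a\,e_\alpha+c\,e_{r_i(\alpha)}&\text{if }(\alpha|\alpha_i)<0,\\ b\,e_{r_i(\alpha)}&\text{if }(\alpha|\alpha_i)>0\text{ and }\alpha\ne\alpha_i.\end{cases}$$ An *LK-family* is a family $(f_i)_{i\in I}$ of linear forms on $V$ such that $f_i(e_{\alpha_j})=0$ for $i\neq j$, $f_i\varphi_j=d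 f_i$ whenever $m_{i,j}=2$, and $f_i\varphi_j=f_j\varphi_i$ whenever $m_{i,j}=3$. When all $f_i(e_{\alpha_i})$ are units, $s_i\mapsto\bigl(v\mapsto\varphi_i(v)+f_i(v)e_{\alpha_i}\bigr)$ defines a representation $\psi:B_\Gamma\to \mathrm{GL}(V)$, called an *LK-representation*. If $G$ is a group of automorphisms of the Coxeter graph $\Gamma$, then $G$ acts on $B_\Gamma$ and (by permutation of the basis) on $V$. The representation $\psi$ restricts to the *twisted LK-representation* $\psi^G:(B_\Gamma)^G\to\mathrm{GL}(V^G)$ on fixed points. Let $n\ge 3$, and let $\Gamma_1=A_{2n-1}$, $\Gamma_2=A_{2n}$, $\Gamma_3=D_{n+1}$, labelled $1,2,\dots$ in the usual way (for $D_{n+1}$, the ends of the fork are $n$ and $n+1$). Let $G_k$ be the group of order two generated by the non-trivial symmetry of $\Gamma_k$ for $k=1,2$, and by the exchange of $n$ and $n+1$ for $k=3$. Let $B$ be the Artin–Tits group of type $B_n$, with standard generators $\Delta_1,\dots,\Delta_n$, where $\Delta_{n-1},\Delta_n$ are the ends of the edge labelled $4$. It is mapped to $(B_{\Gamma_k})^{G_k}$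 by $$\begin{array}{c|cc} & \Delta_i\ (1\le i<n) & \Delta_n\\ \hline k=1& s_is_{2n-i} & s_n\\ k=2& s_is_{2n+1-i} & s_ns_{n+1}s_n\\ k=3& s_i & s_ns_{n+1}\end{array}$$ so every LK-representation $\psi_k$ of $B_{\Gamma_k}$ gives a representation $\psi_k^{G_k}$ of $B$ on $V_k^{G_k}$. Two representations of $B$ over $R$ are *equivalent* if there is an $R$-linear isomorphism between their modules that commutes with the actions of $B$. **Proposition.** 1. Let $p,q,r\in\mathbb Z$ with $2r\ne p+q$, let $R=\mathbb Z[x^{\pm1},y^{\pm1}]$ and $(b,c,d)=(y^p,y^q,y^r)$. There is a set $S$ of at most two integers, depending only on $p,q,r$, which is empty unless $r<0<p+q$ or $p+q<0<r$, such that for all $n\ge 3$ with $n\notin S$, and for all LK-representations $\psi_1$ of $B_{A_{2n-1}}$ and $\psi_3$ of $B_{D_{n+1}}$ with these parameters, the representations $\psi_1^{G_1}$ and $\psi_3^{G_3}$ of $B$ are not equivalent. 2. Let $R$ be any non-zero commutative ring, $b,c,d\in R^\times$ and $n\ge 3$. The modules $V_1^{G_1}$, $V_2^{G_2}$ and $V_3^{G_3}$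 are free, of rank $n^2$, $n(n+1)$ and $n^2$ respectively. Consequently, for all LK-representations $\psi_1,\psi_2,\psi_3$ of $B_{\Gamma_1},B_{\Gamma_2},B_{\Gamma_3}$ with parameters $(b,c,d)$, the representation $\psi_2^{G_2}$ is equivalent neither to $\psi_1^{G_1}$ nor to $\psi_3^{G_3}$. -/

import Mathlib

namespace LawrenceKrammer

/-- The alternating product `x y x ⋯` with `m` factors. -/
def altProd {G : Type*} [Monoid G] (x y : G) : ℕ → G
  | 0 => 1
  | m + 1 => x * altProd y x m

/-- The defining relators of the Artin-Tits group of a Coxeter matrix: for all `i, j`, the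
alternating products of `s i` and `s j` with `M i j` factors agree (no condition if `M i j = 0`,
which stands for `∞`). -/
def artinRels {I : Type*} (M : CoxeterMatrix I) : Set (FreeGroup I) :=
  {r | ∃ i j : I, r = altProd (FreeGroup.of i) (FreeGroup.of j) (M i j) *
    (altProd (FreeGroup.of j) (FreeGroup.of i) (M i j))⁻¹}

/-- The Artin-Tits group of a Coxeter matrix. -/
abbrev ArtinGroup {I : Type*} (M : CoxeterMatrix I) : Type _ := PresentedGroup (artinRels M)

/-- The standard generators of the Artin-Tits group. -/
def gen {I : Type*} (M : CoxeterMatrix I) (i : I) : ArtinGroup M := PresentedGroup.of i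

theorem map_altProd {G H : Type*} [Monoid G] [Monoid H] (F : G →* H) (x y : G) (m : ℕ) :
    F (altProd x y m) = altProd (F x) (F y) m := by
  induction m generalizing x y with
  | zero => simp [altProd]
  | succ m ih => simp [altProd, ih]

theorem gen_rel {I : Type*} (M : CoxeterMatrix I) (i j : I) :
    altProd (gen M i) (gen M j) (M i j) = altProd (gen M j) (gen M i) (M i j) := by
  have h : PresentedGroup.mk (artinRels M) (altProd (FreeGroup.of i) (FreeGroup.of j) (M i j)) =
      PresentedGroup.mk (artinRels M) (altProd (FreeGroup.of j) (FreeGroup.of i) (M i j)) :=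
    PresentedGroup.mk_eq_mk_of_mul_inv_mem ⟨i, j, rfl⟩
  rw [map_altProd, map_altProd] at h
  exact h

/-- The universal property of the Artin-Tits group. -/
def artinLift {I : Type*} (M : CoxeterMatrix I) {G : Type*} [Group G] (x : I → G)
    (h : ∀ i j, altProd (x i) (x j) (M i j) = altProd (x j) (x i) (M i j)) :
    ArtinGroup M →* G :=
  PresentedGroup.toGroup (f := x) (by
    rintro r ⟨i, j, rfl⟩
    simp [map_altProd, h i j])

@[simp]
theorem artinLift_gen {I : Type*} (M : CoxeterMatrix I) {G : Type*} [Group G] (x : I → G)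
    (h : ∀ i j, altProd (x i) (x j) (M i j) = altProd (x j) (x i) (M i j)) (i : I) :
    artinLift M x h (gen M i) = x i :=
  PresentedGroup.toGroup.of _

section RootSystem

set_option linter.unusedSectionVars false

variable {I : Type*} [Fintype I] [DecidableEq I] (M : CoxeterMatrix I)

/-- The Gram matrix `-2 cos (π / m i j)` of the simple roots, for a Coxeter matrix of small type
(all entries in `{1, 2, 3}`), for which it is integral. -/
def gram : Matrix I I ℤ :=
  Matrix.of fun i j => if i = j then 2 else if M i j = 3 then -1 else 0

/-- The symmetric bilinear form on the lattice `⊕ ℤ α i`. As the Gram matrix is integral,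
all the roots lie in this lattice. -/
noncomputable def form : LinearMap.BilinForm ℤ (I → ℤ) := Matrix.toBilin' (gram M)

/-- The simple root `α i`. -/
def simpleRoot (i : I) : I → ℤ := Pi.single i 1

/-- The reflection `s i`. -/
noncomputable def reflect (i : I) (v : I → ℤ) : I → ℤ :=
  v - form M v (simpleRoot i) • simpleRoot i

/-- The root system: the orbits of the simple roots under the group generated by the `s i`. -/
inductive IsRoot : (I → ℤ) → Prop
  | simple (i : I) : IsRoot (simpleRoot i)
  | reflect (i : I) (v : I → ℤ) : IsRoot v → IsRoot (reflect M i v)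

/-- Positive roots: roots with nonnegative coordinates in the basis of simple roots. -/
def IsPosRoot (v : I → ℤ) : Prop := IsRoot M v ∧ 0 ≤ v

/-- The set of positive roots. -/
abbrev PosRoot : Type _ := {v : I → ℤ // IsPosRoot M v}

/-- Irreducible, spherical Coxeter matrices of small type (type `ADE`). -/
structure IsADE : Prop where
  small : ∀ i j, i ≠ j → M i j = 2 ∨ M i j = 3
  posDef : ∀ v : I → ℤ, v ≠ 0 → 0 < form M v v
  connected : ∀ i j, Relation.ReflTransGen (fun k l => M k l = 3) i j

variable {M}

theorem isPosRoot_simpleRoot (i : I) : IsPosRoot M (simpleRoot i) :=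
  ⟨.simple i, by simp [simpleRoot, Pi.single_nonneg]⟩

theorem gram_symm (i j : I) : gram M i j = gram M j i := by
  simp only [gram, Matrix.of_apply, eq_comm (a := i), M.symmetric i j]

theorem form_simple (i j : I) : form M (simpleRoot i) (simpleRoot j) = gram M i j := by
  simp [form, simpleRoot]

theorem form_simple_self (i : I) : form M (simpleRoot i) (simpleRoot i) = 2 := by
  simp [form_simple, gram]

theorem form_symm (v w : I → ℤ) : form M v w = form M w v := by
  simp only [form, Matrix.toBilin'_apply]
  rw [Finset.sum_comm]
  refine Finset.sum_congr rfl fun i _ => Finset.sum_congr rfl fun j _ => ?_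
  rw [gram_symm]; ring

theorem form_reflect_self (i : I) (v : I → ℤ) :
    form M (reflect M i v) (reflect M i v) = form M v v := by
  simp only [reflect, map_sub, map_smul, LinearMap.sub_apply, LinearMap.smul_apply, smul_eq_mul,
    form_simple_self, form_symm (simpleRoot i) v]
  ring

theorem IsRoot.norm {v : I → ℤ} (h : IsRoot M v) : form M v v = 2 := by
  induction h with
  | simple i => exact form_simple_self i
  | reflect i v _ ih => rw [form_reflect_self, ih]

theorem form_even (v : I → ℤ) : Even (form M v v) := by
  have hv : v = ∑ i, v i • simpleRoot i := by
    ext j; simp [simpleRoot, Finset.sum_apply, Pi.single_apply]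
  rw [hv]
  refine Finset.sum_induction (fun i => v i • simpleRoot i) (fun w => Even (form M w w))
    ?_ (by simp) ?_
  · intro v w hv hw
    have : form M (v + w) (v + w) = form M v v + form M w w + 2 * form M v w := by
      simp only [map_add, LinearMap.add_apply, form_symm w v]; ring
    rw [this]
    exact (hv.add hw).add (even_two_mul _)
  · intro i _
    simp only [map_smul, LinearMap.smul_apply, smul_eq_mul, form_simple_self]
    exact ⟨v i * v i, by ring⟩

theorem IsADE.nonneg (hM : IsADE M) (v : I → ℤ) : 0 ≤ form M v v := by
  by_cases h : v = 0
  · simp [h]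
  · exact (hM.posDef v h).le

theorem IsADE.eq_zero (hM : IsADE M) {v : I → ℤ} (h : form M v v ≤ 0) : v = 0 := by
  by_contra h'
  exact absurd (hM.posDef v h') (not_lt.2 h)

theorem form_nonpos {v w : I → ℤ} (hv : 0 ≤ v) (hw : 0 ≤ w) (h : ∀ i, v i * w i = 0) :
    form M v w ≤ 0 := by
  simp only [form, Matrix.toBilin'_apply]
  refine Finset.sum_nonpos fun i _ => Finset.sum_nonpos fun j _ => ?_
  have hi := hv i
  have hj := hw j
  simp only [Pi.zero_apply] at hi hj
  by_cases hij : i = j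
  · subst hij
    rw [mul_right_comm, h i, zero_mul]
  · simp only [gram, Matrix.of_apply, hij, if_false]
    split_ifs
    · nlinarith [mul_nonneg hi hj]
    · simp

/-- A root of a spherical type is positive or negative. -/
theorem IsADE.sign (hM : IsADE M) {v : I → ℤ} (h : IsRoot M v) : 0 ≤ v ∨ v ≤ 0 := by
  have h1 : v = v⁺ - v⁻ := (posPart_sub_negPart v).symm
  have h2 : form M v⁺ v⁻ ≤ 0 := by
    refine form_nonpos (posPart_nonneg v) (negPart_nonneg v) fun i => ?_
    simp only [Pi.posPart_apply, Pi.negPart_apply]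
    rcases le_total 0 (v i) with h | h
    · simp [negPart_eq_zero.2 h]
    · simp [posPart_eq_zero.2 h]
  have h3 : form M v v = form M v⁺ v⁺ + form M v⁻ v⁻ - 2 * form M v⁺ v⁻ := by
    conv_lhs => rw [h1]
    simp only [map_sub, LinearMap.sub_apply, form_symm v⁻ v⁺]
    ring
  rw [h.norm] at h3
  by_cases hp : v⁺ = 0
  · right; rw [h1, hp]; simp [negPart_nonneg v]
  by_cases hn : v⁻ = 0
  · left; rw [h1, hn]; simp [posPart_nonneg v]
  have := hM.posDef _ hp
  have := hM.posDef _ hn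
  obtain ⟨x, hx⟩ := form_even (M := M) v⁺
  obtain ⟨y, hy⟩ := form_even (M := M) v⁻
  omega

theorem IsADE.form_le (hM : IsADE M) {v w : I → ℤ} (hv : IsRoot M v) (hw : IsRoot M w)
    (hne : v ≠ w) : form M v w ≤ 1 := by
  by_contra h
  apply hne
  rw [← sub_eq_zero]
  apply hM.eq_zero
  simp only [map_sub, LinearMap.sub_apply, form_symm w v, hv.norm, hw.norm]
  omega

theorem IsADE.le_form (hM : IsADE M) {v w : I → ℤ} (hv : IsRoot M v) (hw : IsRoot M w)
    (hne : v + w ≠ 0) : -1 ≤ form M v w := by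
  by_contra h
  apply hne
  apply hM.eq_zero
  simp only [map_add, LinearMap.add_apply, form_symm w v, hv.norm, hw.norm]
  omega

theorem simpleRoot_ne_zero (i : I) : simpleRoot i ≠ (0 : I → ℤ) := by
  simp [simpleRoot]

theorem simpleRoot_nonneg (i : I) : (0 : I → ℤ) ≤ simpleRoot i :=
  Pi.single_nonneg.2 zero_le_one

theorem IsPosRoot.ne_zero {v : I → ℤ} (h : IsPosRoot M v) : v ≠ 0 := by
  rintro rfl
  simpa using h.1.norm

/-- The possible values of `(v | α i)` for a positive root `v`; the value `2` means `v = α i`. -/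
theorem IsADE.form_cases (hM : IsADE M) {v : I → ℤ} (hv : IsPosRoot M v) (i : I) :
    (v = simpleRoot i ∧ form M v (simpleRoot i) = 2) ∨
    (v ≠ simpleRoot i ∧ (form M v (simpleRoot i) = -1 ∨ form M v (simpleRoot i) = 0 ∨
      form M v (simpleRoot i) = 1)) := by
  by_cases h : v = simpleRoot i
  · left; exact ⟨h, by rw [h, form_simple_self]⟩
  · right
    refine ⟨h, ?_⟩
    have h1 := hM.form_le hv.1 (.simple i) h
    have h2 := hM.le_form hv.1 (.simple i) (by
      intro h0
      have : v i + 1 = 0 := by simpa [simpleRoot] using congrFun h0 i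
      have := hv.2 i
      simp at this
      omega)
    omega

/-- `s i` permutes the positive roots other than `α i`. -/
theorem IsADE.reflect_pos (hM : IsADE M) {v : I → ℤ} (hv : IsPosRoot M v) {i : I}
    (h : v ≠ simpleRoot i) : IsPosRoot M (reflect M i v) := by
  refine ⟨.reflect i v hv.1, ?_⟩
  rcases hM.sign (.reflect i v hv.1) with h1 | h1
  · exact h1
  exfalso
  have h2 : ∀ j, j ≠ i → v j = 0 := by
    intro j hj
    have a1 := h1 j
    have a2 := hv.2 j
    simp [reflect, simpleRoot, hj] at a1 a2
    omega
  have h3 : v = v i • simpleRoot i := by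
    ext j
    by_cases hj : j = i
    · subst hj; simp [simpleRoot]
    · simp [simpleRoot, hj, h2 j hj]
  have h4 := hv.1.norm
  rw [h3] at h4
  simp only [map_smul, LinearMap.smul_apply, smul_eq_mul, form_simple_self] at h4
  have h5 : 0 ≤ v i := hv.2 i
  have h6 : v i = 1 := by nlinarith
  rw [h6, one_smul] at h3
  exact h h3

theorem IsADE.sub_pos (hM : IsADE M) {v : I → ℤ} (hv : IsPosRoot M v) {i : I}
    (h : form M v (simpleRoot i) = 1) : IsPosRoot M (v - simpleRoot i) := by
  have := hM.reflect_pos hv (i := i) (by rintro rfl; simp [form_simple_self] at h)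
  simpa [reflect, h] using this

theorem IsADE.add_pos (hM : IsADE M) {v : I → ℤ} (hv : IsPosRoot M v) {i : I}
    (h : form M v (simpleRoot i) = -1) : IsPosRoot M (v + simpleRoot i) := by
  have := hM.reflect_pos hv (i := i) (by rintro rfl; simp [form_simple_self] at h)
  simpa [reflect, h] using this

/-- The parameters `b, c, d`, units of the ring `R`. -/
structure Param (R : Type*) [CommRing R] where
  b : Rˣ
  c : Rˣ
  d : Rˣ

/-- The parameter `a = d - b c / d`. -/
def Param.a {R : Type*} [CommRing R] (P : Param R) : R := P.d - P.b * P.c * (P.d⁻¹ : Rˣ)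

theorem Param.rel {R : Type*} [CommRing R] (P : Param R) :
    (P.d : R) * P.d = P.a * P.d + P.b * P.c := by
  have : (P.d : R) * (P.d⁻¹ : Rˣ) = 1 := P.d.mul_inv
  rw [Param.a]
  linear_combination ((P.b * P.c) : R) * this

variable (M) (R : Type*) [CommRing R]

/-- The free `R`-module `V` with basis the positive roots. -/
abbrev LKModule : Type _ := PosRoot M →₀ R

open Classical in
/-- The basis vector `e v` of `V` if `v` is a positive root (and `0` otherwise). -/
noncomputable def basisVec (v : I → ℤ) : LKModule M R :=
  if h : IsPosRoot M v then Finsupp.single ⟨v, h⟩ 1 else 0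

variable {R} (P : Param R)

/-- The endomorphism `φ i` of `V`, given on a basis vector `e v` by
* `0` if `v = α i`;
* `d e v` if `(v | α i) = 0`, i.e. `s i v = v`;
* `a e v + c e (s i v)` if `(v | α i) < 0`, i.e. the depth of `s i v` is that of `v` plus `1`;
* `b e (s i v)` if `(v | α i) > 0`, i.e. the depth of `s i v` is that of `v` minus `1`. -/
noncomputable def phi (i : I) : Module.End R (LKModule M R) :=
  Finsupp.linearCombination R fun v : PosRoot M =>
    if v.1 = simpleRoot i then 0
    else if form M v.1 (simpleRoot i) = 0 then (P.d : R) • basisVec M R v.1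
    else if form M v.1 (simpleRoot i) < 0 then
      P.a • basisVec M R v.1 + (P.c : R) • basisVec M R (reflect M i v.1)
    else (P.b : R) • basisVec M R (reflect M i v.1)

/-- LK-families `(f i)` of linear forms on `V`. -/
structure IsLKFamily (f : I → Module.Dual R (LKModule M R)) : Prop where
  simple : ∀ i j, i ≠ j → f i (basisVec M R (simpleRoot j)) = 0
  comm : ∀ i j, M i j = 2 → f i ∘ₗ phi M P j = (P.d : R) • f i
  braid : ∀ i j, M i j = 3 → f i ∘ₗ phi M P j = f j ∘ₗ phi M P i

/-- LK-families `(f i)` such that every `f i (e (α i))` is a unit: these are the families whose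
LK-representation has invertible images. -/
structure LKFamilyGr where
  f : I → Module.Dual R (LKModule M R)
  isLKFamily : IsLKFamily M P f
  isUnit : ∀ i, IsUnit (f i (basisVec M R (simpleRoot i)))

/-- The endomorphism `ψ i = φ i + f i ⊠ e (α i)` of `V`. -/
noncomputable def psi (f : I → Module.Dual R (LKModule M R)) (i : I) :
    Module.End R (LKModule M R) :=
  phi M P i + (f i).smulRight (basisVec M R (simpleRoot i))

variable {M P}

theorem basisVec_of_pos {v : I → ℤ} (h : IsPosRoot M v) :
    basisVec M R v = Finsupp.single ⟨v, h⟩ 1 := by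
  rw [basisVec, dif_pos h]

theorem lk_ext {N : Type*} [AddCommGroup N] [Module R N] {F G : LKModule M R →ₗ[R] N}
    (h : ∀ v, IsPosRoot M v → F (basisVec M R v) = G (basisVec M R v)) : F = G := by
  refine Finsupp.lhom_ext' fun v => LinearMap.ext_ring ?_
  simpa [basisVec_of_pos v.2] using h v.1 v.2

theorem phi_aux (i : I) {v : I → ℤ} (hv : IsPosRoot M v) :
    phi M P i (basisVec M R v) = if v = simpleRoot i then 0
    else if form M v (simpleRoot i) = 0 then (P.d : R) • basisVec M R v
    else if form M v (simpleRoot i) < 0 then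
      P.a • basisVec M R v + (P.c : R) • basisVec M R (reflect M i v)
    else (P.b : R) • basisVec M R (reflect M i v) := by
  rw [basisVec_of_pos hv, phi, Finsupp.linearCombination_single, one_smul, ← basisVec_of_pos hv]

theorem phi_simple (i : I) : phi M P i (basisVec M R (simpleRoot i)) = 0 := by
  rw [phi_aux i (isPosRoot_simpleRoot i), if_pos rfl]

theorem phi_zero {i : I} {v : I → ℤ} (hv : IsPosRoot M v) (h : form M v (simpleRoot i) = 0) :
    phi M P i (basisVec M R v) = (P.d : R) • basisVec M R v := by
  have : v ≠ simpleRoot i := by rintro rfl; simp [form_simple_self] at h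
  rw [phi_aux i hv, if_neg this, if_pos h]

theorem phi_up {i : I} {v : I → ℤ} (hv : IsPosRoot M v) (h : form M v (simpleRoot i) = -1) :
    phi M P i (basisVec M R v) =
      P.a • basisVec M R v + (P.c : R) • basisVec M R (v + simpleRoot i) := by
  have : v ≠ simpleRoot i := by rintro rfl; simp [form_simple_self] at h
  rw [phi_aux i hv, if_neg this, if_neg (by omega), if_pos (by omega), reflect, h]
  simp

theorem phi_down {i : I} {v : I → ℤ} (hv : IsPosRoot M v) (h : form M v (simpleRoot i) = 1) :
    phi M P i (basisVec M R v) = (P.b : R) • basisVec M R (v - simpleRoot i) := by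
  have : v ≠ simpleRoot i := by rintro rfl; simp [form_simple_self] at h
  rw [phi_aux i hv, if_neg this, if_neg (by omega), if_neg (by omega), reflect, h]
  simp

theorem form_add_simple (v : I → ℤ) (i j : I) :
    form M (v + simpleRoot i) (simpleRoot j) = form M v (simpleRoot j) + gram M i j := by
  simp [form_simple]

theorem form_sub_simple (v : I → ℤ) (i j : I) :
    form M (v - simpleRoot i) (simpleRoot j) = form M v (simpleRoot j) - gram M i j := by
  simp [form_simple]

theorem gram_self (i : I) : gram M i i = 2 := by simp [gram]

theorem gram_two {i j : I} (h : M i j = 2) : gram M i j = 0 := by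
  have : i ≠ j := by rintro rfl; simp at h
  simp [gram, this, h]

theorem gram_three {i j : I} (h : M i j = 3) : gram M i j = -1 := by
  have : i ≠ j := by rintro rfl; simp at h
  simp [gram, this, h]

theorem phi_comm (hM : IsADE M) {i j : I} (h : M i j = 2) :
    phi M P i * phi M P j = phi M P j * phi M P i := by
  have g1 : gram M i j = 0 := gram_two h
  have g2 : gram M j i = 0 := by rw [gram_symm, g1]
  refine lk_ext fun v hv => ?_
  simp only [Module.End.mul_apply]
  rcases hM.form_cases hv i with ⟨rfl, hi⟩ | ⟨-, hi⟩
  · rw [phi_simple, phi_zero hv (by rw [form_simple, g1])]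
    simp [phi_simple]
  rcases hM.form_cases hv j with ⟨rfl, hj⟩ | ⟨-, hj⟩
  · rw [phi_simple, phi_zero hv (by rw [form_simple, g2])]
    simp [phi_simple]
  have ai : form M (v + simpleRoot i) (simpleRoot j) = form M v (simpleRoot j) := by
    rw [form_add_simple, g1, add_zero]
  have si : form M (v - simpleRoot i) (simpleRoot j) = form M v (simpleRoot j) := by
    rw [form_sub_simple, g1, sub_zero]
  have aj : form M (v + simpleRoot j) (simpleRoot i) = form M v (simpleRoot i) := by
    rw [form_add_simple, g2, add_zero]
  have sj : form M (v - simpleRoot j) (simpleRoot i) = form M v (simpleRoot i) := by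
    rw [form_sub_simple, g2, sub_zero]
  rcases hi with hi | hi | hi <;> rcases hj with hj | hj | hj
  · rw [phi_up hv hi, phi_up hv hj, map_add, map_add, map_smul, map_smul, map_smul, map_smul,
      phi_up hv hi, phi_up hv hj, phi_up (hM.add_pos hv hi) (ai.trans hj),
      phi_up (hM.add_pos hv hj) (aj.trans hi), add_right_comm v]
    module
  · rw [phi_up hv hi, phi_zero hv hj, map_add, map_smul, map_smul, map_smul,
      phi_up hv hi, phi_zero hv hj, phi_zero (hM.add_pos hv hi) (ai.trans hj)]
    module
  · rw [phi_up hv hi, phi_down hv hj, map_add, map_smul, map_smul, map_smul,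
      phi_down hv hj, phi_down (hM.add_pos hv hi) (ai.trans hj),
      phi_up (hM.sub_pos hv hj) (sj.trans hi), sub_add_eq_add_sub]
    module
  · rw [phi_zero hv hi, phi_up hv hj, map_add, map_smul, map_smul, map_smul,
      phi_zero hv hi, phi_up hv hj, phi_zero (hM.add_pos hv hj) (aj.trans hi)]
    module
  · rw [phi_zero hv hi, phi_zero hv hj, map_smul, map_smul, phi_zero hv hi, phi_zero hv hj]
  · rw [phi_zero hv hi, phi_down hv hj, map_smul, map_smul, phi_down hv hj,
      phi_zero (hM.sub_pos hv hj) (sj.trans hi)]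
    module
  · rw [phi_down hv hi, phi_up hv hj, map_add, map_smul, map_smul, map_smul,
      phi_down hv hi, phi_down (hM.add_pos hv hj) (aj.trans hi),
      phi_up (hM.sub_pos hv hi) (si.trans hj), sub_add_eq_add_sub]
    module
  · rw [phi_down hv hi, phi_zero hv hj, map_smul, map_smul, phi_down hv hi,
      phi_zero (hM.sub_pos hv hi) (si.trans hj)]
    module
  · rw [phi_down hv hi, phi_down hv hj, map_smul, map_smul,
      phi_down (hM.sub_pos hv hi) (si.trans hj), phi_down (hM.sub_pos hv hj) (sj.trans hi),
      sub_right_comm]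

/-- One half of the cases of the braid relation for the `φ i`. -/
theorem phi_braid_aux (hM : IsADE M) {i j : I} (h : M i j = 3) {v : I → ℤ} (hv : IsPosRoot M v)
    (hc : v = simpleRoot i ∨
      (form M v (simpleRoot i) = 1 ∧ form M v (simpleRoot j) = 0) ∨
      (form M v (simpleRoot i) = -1 ∧ form M v (simpleRoot j) = 0) ∨
      (form M v (simpleRoot i) = 1 ∧ form M v (simpleRoot j) = -1)) :
    phi M P i (phi M P j (phi M P i (basisVec M R v))) =
      phi M P j (phi M P i (phi M P j (basisVec M R v))) := by
  have g1 : gram M i j = -1 := gram_three h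
  have g2 : gram M j i = -1 := by rw [gram_symm, g1]
  rcases hc with rfl | ⟨hi, hj⟩ | ⟨hi, hj⟩ | ⟨hi, hj⟩
  · have hj : form M (simpleRoot i) (simpleRoot j) = -1 := by rw [form_simple, g1]
    rw [phi_simple, phi_up hv hj, map_add, map_smul, map_smul, phi_simple,
      phi_down (hM.add_pos hv hj) (by rw [form_add_simple, form_simple_self, g2]; norm_num),
      add_sub_cancel_left]
    simp [phi_simple]
  · have w := hM.sub_pos hv hi
    have w1 : form M (v - simpleRoot i) (simpleRoot j) = 1 := by
      rw [form_sub_simple, g1, hj]; norm_num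
    have x := hM.sub_pos w w1
    have x1 : form M (v - simpleRoot i - simpleRoot j) (simpleRoot i) = 0 := by
      rw [form_sub_simple, form_sub_simple, g2, gram_self, hi]; norm_num
    rw [phi_down hv hi, map_smul, phi_down w w1, map_smul, map_smul, phi_zero x x1,
      phi_zero hv hj, map_smul, map_smul, phi_down hv hi, map_smul, phi_down w w1]
    module
  · have w := hM.add_pos hv hi
    have w1 : form M (v + simpleRoot i) (simpleRoot j) = -1 := by
      rw [form_add_simple, g1, hj]; norm_num
    have w2 : form M (v + simpleRoot i) (simpleRoot i) = 1 := by
      rw [form_add_simple, gram_self, hi]; norm_num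
    have x := hM.add_pos w w1
    have x1 : form M (v + simpleRoot i + simpleRoot j) (simpleRoot i) = 0 := by
      rw [form_add_simple, form_add_simple, g2, gram_self, hi]; norm_num
    simp only [phi_up hv hi, phi_zero hv hj, map_add, map_smul, phi_up w w1, phi_down w w2,
      phi_zero x x1, add_sub_cancel_right]
    match_scalars
    · linear_combination (-P.a : R) * P.rel
    · ring
    · ring
  · have w := hM.sub_pos hv hi
    have w1 : form M (v - simpleRoot i) (simpleRoot j) = 0 := by
      rw [form_sub_simple, g1, hj]; norm_num
    have w2 : form M (v - simpleRoot i) (simpleRoot i) = -1 := by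
      rw [form_sub_simple, gram_self, hi]; norm_num
    have x := hM.add_pos hv hj
    have x1 : form M (v + simpleRoot j) (simpleRoot i) = 0 := by
      rw [form_add_simple, g2, hi]; norm_num
    have x2 : form M (v + simpleRoot j) (simpleRoot j) = 1 := by
      rw [form_add_simple, gram_self, hj]; norm_num
    simp only [phi_down hv hi, phi_up hv hj, map_add, map_smul, phi_zero w w1, phi_up w w2,
      phi_zero x x1, phi_down x x2, add_sub_cancel_right, sub_add_cancel]
    module

theorem phi_braid (hM : IsADE M) {i j : I} (h : M i j = 3) :
    phi M P i * phi M P j * phi M P i = phi M P j * phi M P i * phi M P j := by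
  have g1 : gram M i j = -1 := gram_three h
  have g2 : gram M j i = -1 := by rw [gram_symm, g1]
  have h' : M j i = 3 := by rw [M.symmetric, h]
  refine lk_ext fun v hv => ?_
  simp only [Module.End.mul_apply]
  have A := phi_braid_aux (R := R) (P := P) hM h hv
  have B := fun hc => (phi_braid_aux (R := R) (P := P) hM h' hv hc).symm
  rcases hM.form_cases hv i with ⟨e, hi⟩ | ⟨-, hi⟩
  · exact A (Or.inl e)
  rcases hM.form_cases hv j with ⟨e, hj⟩ | ⟨-, hj⟩
  · exact B (Or.inl e)
  rcases hi with hi | hi | hi <;> rcases hj with hj | hj | hj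
  · exfalso
    have := hM.form_cases (hM.add_pos hv hi) j
    rw [form_add_simple, g1, hj] at this
    omega
  · exact A (by simp [hi, hj])
  · exact B (by simp [hi, hj])
  · exact B (by simp [hi, hj])
  · simp only [phi_zero hv hi, phi_zero hv hj, map_smul]
  · exact B (by simp [hi, hj])
  · exact A (by simp [hi, hj])
  · exact A (by simp [hi, hj])
  · have e1 : v - simpleRoot i = simpleRoot j := by
      have := hM.form_cases (hM.sub_pos hv hi) j
      rw [form_sub_simple, g1, hj] at this
      rcases this with h | h
      · exact h.1
      · omega
    have e2 : v - simpleRoot j = simpleRoot i := by rw [← e1]; abel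
    rw [phi_down hv hi, phi_down hv hj, e1, e2]
    simp [phi_simple]

/-- The coordinate along `e (α i)`. -/
noncomputable def coord (R : Type*) [CommRing R] (i : I) : Module.Dual R (LKModule M R) :=
  Finsupp.lapply ⟨simpleRoot i, isPosRoot_simpleRoot i⟩

theorem coord_simple (i : I) : coord R i (basisVec M R (simpleRoot i)) = 1 := by
  rw [basisVec_of_pos (isPosRoot_simpleRoot i)]
  simp [coord]

theorem coord_ne (i : I) {v : I → ℤ} (hv : IsPosRoot M v) (h : v ≠ simpleRoot i) :
    coord R i (basisVec M R v) = 0 := by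
  rw [basisVec_of_pos hv, coord, Finsupp.lapply_apply, Finsupp.single_apply, if_neg]
  simpa [Subtype.ext_iff] using h

theorem phi_sq (hM : IsADE M) (i : I) (x : LKModule M R) :
    phi M P i (phi M P i x) = P.a • phi M P i x + (P.b * P.c : R) • x -
      (P.b * P.c * coord R i x : R) • basisVec M R (simpleRoot i) := by
  have : phi M P i ∘ₗ phi M P i = P.a • phi M P i + (P.b * P.c : R) • LinearMap.id -
      (P.b * P.c : R) • (coord R i).smulRight (basisVec M R (simpleRoot i)) := by
    refine lk_ext fun v hv => ?_
    simp only [LinearMap.comp_apply, LinearMap.sub_apply, LinearMap.add_apply,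
      LinearMap.smul_apply, LinearMap.id_apply, LinearMap.smulRight_apply]
    rcases hM.form_cases hv i with ⟨rfl, hi⟩ | ⟨hne, hi⟩
    · simp [phi_simple, coord_simple]
    rw [coord_ne i hv hne]
    rcases hi with hi | hi | hi
    · have w := hM.add_pos hv hi
      have w1 : form M (v + simpleRoot i) (simpleRoot i) = 1 := by
        rw [form_add_simple, gram_self, hi]; norm_num
      simp only [phi_up hv hi, map_add, map_smul, phi_down w w1, add_sub_cancel_right]
      module
    · simp only [phi_zero hv hi, map_smul]
      match_scalars
      · linear_combination P.rel
      · simp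
    · have w := hM.sub_pos hv hi
      have w1 : form M (v - simpleRoot i) (simpleRoot i) = -1 := by
        rw [form_sub_simple, gram_self, hi]; norm_num
      simp only [phi_down hv hi, map_smul, phi_up w w1, sub_add_cancel]
      module
  have h2 := LinearMap.congr_fun this x
  simpa [mul_smul] using h2

variable {f : I → Module.Dual R (LKModule M R)}

theorem psi_apply (i : I) (x : LKModule M R) :
    psi M P f i x = phi M P i x + f i x • basisVec M R (simpleRoot i) := rfl

theorem psi_comm (hM : IsADE M) (hf : IsLKFamily M P f) {i j : I} (h : M i j = 2) :
    psi M P f i * psi M P f j = psi M P f j * psi M P f i := by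
  have h' : M j i = 2 := by rw [M.symmetric, h]
  have hij : i ≠ j := by rintro rfl; simp at h
  refine LinearMap.ext fun x => ?_
  have a1 := LinearMap.congr_fun (phi_comm (P := P) (R := R) hM h) x
  have a2 := LinearMap.congr_fun (hf.comm i j h) x
  have a3 := LinearMap.congr_fun (hf.comm j i h') x
  simp only [Module.End.mul_apply, LinearMap.comp_apply, LinearMap.smul_apply,
    smul_eq_mul] at a1 a2 a3
  simp only [Module.End.mul_apply, psi_apply, map_add, map_smul, a1, a2, a3,
    hf.simple i j hij, hf.simple j i hij.symm,
    phi_zero (isPosRoot_simpleRoot j) (by rw [form_simple, gram_two h'] :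
      form M (simpleRoot j) (simpleRoot i) = 0),
    phi_zero (isPosRoot_simpleRoot i) (by rw [form_simple, gram_two h] :
      form M (simpleRoot i) (simpleRoot j) = 0)]
  module

theorem psi_three (hM : IsADE M) (hf : IsLKFamily M P f) {i j : I} (h : M i j = 3)
    (x : LKModule M R) :
    psi M P f i (psi M P f j (psi M P f i x)) = phi M P i (phi M P j (phi M P i x)) +
      (P.b * P.c * f i x : R) • basisVec M R (simpleRoot j) +
      (P.b * P.c * f j x : R) • basisVec M R (simpleRoot i) +
      f i (phi M P j x) • (P.a • (basisVec M R (simpleRoot i) + basisVec M R (simpleRoot j)) +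
        (P.c : R) • basisVec M R (simpleRoot i + simpleRoot j)) := by
  have h' : M j i = 3 := by rw [M.symmetric, h]
  have hij : i ≠ j := by rintro rfl; simp at h
  have F : ∀ y, f i (phi M P j y) = f j (phi M P i y) := fun y =>
    LinearMap.congr_fun (hf.braid i j h) y
  have gj : form M (simpleRoot i) (simpleRoot j) = -1 := by rw [form_simple, gram_three h]
  have gi : form M (simpleRoot j) (simpleRoot i) = -1 := by rw [form_simple, gram_three h']
  have e1 := phi_up (P := P) (R := R) (isPosRoot_simpleRoot i) gj
  have e2 := phi_up (P := P) (R := R) (isPosRoot_simpleRoot j) gi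
  have e3 := phi_down (P := P) (R := R) (hM.add_pos (isPosRoot_simpleRoot i) gj)
    (i := i) (by rw [form_add_simple, form_simple_self, gram_three h']; norm_num)
  rw [add_sub_cancel_left] at e3
  rw [add_comm (simpleRoot j)] at e2
  have e4 : f i (phi M P j (basisVec M R (simpleRoot i))) = 0 := by
    rw [F, phi_simple, map_zero]
  simp only [psi_apply, map_add, map_smul, hf.simple j i hij.symm, hf.simple i j hij, e1, e2, e3,
    phi_simple, smul_eq_mul, add_zero, zero_add, zero_smul] at e4 ⊢
  rw [F (phi M P i x), phi_sq hM]
  simp only [map_sub, map_add, map_smul, hf.simple j i hij.symm, smul_eq_mul, ← F x]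
  match_scalars
  all_goals try ring1
  linear_combination f i x * e4

theorem psi_braid (hM : IsADE M) (hf : IsLKFamily M P f) {i j : I} (h : M i j = 3) :
    psi M P f i * psi M P f j * psi M P f i = psi M P f j * psi M P f i * psi M P f j := by
  have h' : M j i = 3 := by rw [M.symmetric, h]
  refine LinearMap.ext fun x => ?_
  have F : f i (phi M P j x) = f j (phi M P i x) := LinearMap.congr_fun (hf.braid i j h) x
  have a1 := LinearMap.congr_fun (phi_braid (P := P) (R := R) hM h) x
  simp only [Module.End.mul_apply] at a1 ⊢
  rw [psi_three hM hf h, psi_three hM hf h', a1, F, add_comm (simpleRoot j)]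
  module

theorem psi_isUnit (hM : IsADE M) {i : I}
    (hu : IsUnit (f i (basisVec M R (simpleRoot i)))) : IsUnit (psi M P f i) := by
  obtain ⟨u, hu⟩ := hu
  let e := basisVec M R (simpleRoot i)
  have he : psi M P f i e = (u : R) • e := by rw [psi_apply, phi_simple, ← hu, zero_add]
  have hs : ∀ x, ∃ r : R, psi M P f i (psi M P f i x) =
      P.a • psi M P f i x + (P.b * P.c : R) • x + r • e := by
    intro x
    refine ⟨f i (phi M P i x) + f i x * u - P.a * f i x - P.b * P.c * coord R i x, ?_⟩
    simp only [psi_apply, map_add, map_smul, phi_simple, phi_sq hM, ← hu]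
    module
  have hc : psi M P f i * psi M P f i * psi M P f i = (P.a + u : R) • (psi M P f i * psi M P f i) +
      (P.b * P.c - u * P.a : R) • psi M P f i - (u * (P.b * P.c) : R) • (1 : Module.End R _) := by
    refine LinearMap.ext fun x => ?_
    obtain ⟨r, hr⟩ := hs x
    simp only [Module.End.mul_apply, LinearMap.add_apply, LinearMap.sub_apply,
      LinearMap.smul_apply, Module.End.one_apply]
    rw [hr]
    simp only [map_add, map_smul, he, hr]
    module
  let w : Rˣ := u * (P.b * P.c)
  let Q : Module.End R (LKModule M R) := ((w⁻¹ : Rˣ) : R) • ((P.a + u : R) • psi M P f i +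
      (P.b * P.c - u * P.a : R) • 1 - psi M P f i * psi M P f i)
  have hw : (u * (P.b * P.c) : R) = w := by simp [w]
  have h1 : psi M P f i * Q = 1 := by
    have : psi M P f i * ((P.a + u : R) • psi M P f i + (P.b * P.c - u * P.a : R) • 1 -
        psi M P f i * psi M P f i) = (w : R) • 1 := by
      refine LinearMap.ext fun x => ?_
      have hx := LinearMap.congr_fun hc x
      simp only [Module.End.mul_apply, LinearMap.add_apply, LinearMap.sub_apply,
        LinearMap.smul_apply, Module.End.one_apply, map_add, map_sub, map_smul] at hx ⊢
      rw [hx, hw]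
      module
    rw [mul_smul_comm, this, smul_smul, Units.inv_mul, one_smul]
  have h2 : Q * psi M P f i = 1 := by
    have : ((P.a + u : R) • psi M P f i + (P.b * P.c - u * P.a : R) • 1 -
        psi M P f i * psi M P f i) * psi M P f i = (w : R) • 1 := by
      refine LinearMap.ext fun x => ?_
      have hx := LinearMap.congr_fun hc x
      simp only [Module.End.mul_apply, LinearMap.add_apply, LinearMap.sub_apply,
        LinearMap.smul_apply, Module.End.one_apply] at hx ⊢
      rw [hx, hw]
      module
    rw [smul_mul_assoc, this, smul_smul, Units.inv_mul, one_smul]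
  exact ⟨⟨psi M P f i, Q, h1, h2⟩, rfl⟩

/-- The LK-representation of the Artin-Tits group attached to an LK-family: it maps the generator
`s i` to `ψ i`. -/
noncomputable def lkRep (hM : IsADE M) (F : LKFamilyGr M P) :
    Representation R (ArtinGroup M) (LKModule M R) :=
  (Units.coeHom _).comp (artinLift M (fun i => (psi_isUnit hM (F.isUnit i)).unit) (by
    intro i j
    by_cases hij : i = j
    · rw [hij]
    rcases hM.small i j hij with h | h
    · rw [h]
      ext1
      simpa [altProd] using psi_comm hM F.isLKFamily h
    · rw [h]
      ext1
      simpa [altProd, mul_assoc] using psi_braid hM F.isLKFamily h))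

theorem lkRep_gen (hM : IsADE M) (F : LKFamilyGr M P) (i : I) :
    lkRep hM F (gen M i) = psi M P F.f i := by
  simp [lkRep]

/-- An LK-family of an `ADE` type that vanishes on the `e (α i)` is zero. -/
theorem IsLKFamily.eq_zero (hM : IsADE M) (hf : IsLKFamily M P f)
    (h0 : ∀ i, f i (basisVec M R (simpleRoot i)) = 0) (i : I) : f i = 0 := by
  have hs : ∀ i j, f i (basisVec M R (simpleRoot j)) = 0 := fun i j => by
    by_cases hij : i = j
    · rw [hij, h0]
    · exact hf.simple i j hij
  have hpos : ∀ v, IsPosRoot M v → ∃ j, 0 < form M v (simpleRoot j) := by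
    intro v hv
    by_contra hcon
    push Not at hcon
    have e : form M v v = ∑ j, v j * form M v (simpleRoot j) := by
      conv_lhs => rw [show form M v v = form M v (∑ j, v j • simpleRoot j) by
        congr 1; ext j; simp [simpleRoot, Finset.sum_apply, Pi.single_apply]]
      rw [map_sum]
      refine Finset.sum_congr rfl fun j _ => ?_
      rw [map_smul, smul_eq_mul]
    rw [hv.1.norm] at e
    have : ∑ j, v j * form M v (simpleRoot j) ≤ 0 :=
      Finset.sum_nonpos fun j _ => mul_nonpos_of_nonneg_of_nonpos (hv.2 j) (hcon j)
    omega
  have ht : ∀ j : I, ∑ k, simpleRoot j k = (1 : ℤ) := fun j => by simp [simpleRoot]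
  have key : ∀ n : ℕ, ∀ v, IsPosRoot M v → ∑ k, v k ≤ (n : ℤ) →
      ∀ i, f i (basisVec M R v) = 0 := by
    intro n
    induction n with
    | zero =>
      intro v hv hn
      exfalso
      obtain ⟨k, hk⟩ : ∃ k, v k ≠ 0 := by
        by_contra hcon
        push Not at hcon
        exact hv.ne_zero (funext hcon)
      have hk' : 0 < v k := lt_of_le_of_ne (hv.2 k) (Ne.symm hk)
      have := Finset.single_le_sum (f := v) (fun j _ => hv.2 j) (Finset.mem_univ k)
      simp only [Nat.cast_zero] at hn
      omega
    | succ n ih =>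
      intro v hv hn
      have hlow : ∀ {w : I → ℤ} (j : I), IsPosRoot M w → w + simpleRoot j = v →
          ∀ i, f i (basisVec M R w) = 0 := by
        intro w j hw hwv
        apply ih w hw
        have : ∑ k, v k = ∑ k, w k + 1 := by
          rw [← hwv, ← ht j, ← Finset.sum_add_distrib]; rfl
        push_cast at hn
        omega
      -- the case of an index `j ≠ i` with `(v | α j) = 1`
      have hne : ∀ i j, i ≠ j → form M v (simpleRoot j) = 1 → f i (basisVec M R v) = 0 := by
        intro i j hij hj
        have hw := hM.sub_pos hv hj
        have hwv := sub_add_cancel v (simpleRoot j)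
        rcases hM.small i j hij with h | h
        · have := LinearMap.congr_fun (hf.comm i j h) (basisVec M R v)
          rw [LinearMap.comp_apply, phi_down hv hj, map_smul, hlow j hw hwv, smul_zero] at this
          exact (P.d.isUnit.smul_eq_zero).1 this.symm
        · have h' : M j i = 3 := by rw [M.symmetric, h]
          have hw1 : form M (v - simpleRoot j) (simpleRoot j) = -1 := by
            rw [form_sub_simple, gram_self, hj]; norm_num
          have := LinearMap.congr_fun (hf.braid i j h) (basisVec M R (v - simpleRoot j))
          rw [LinearMap.comp_apply, LinearMap.comp_apply, phi_up hw hw1, hwv, map_add, map_smul,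
            map_smul, hlow j hw hwv, smul_zero, zero_add] at this
          have h0 : f j (phi M P i (basisVec M R (v - simpleRoot j))) = 0 := by
            rcases hM.form_cases hw i with ⟨e, -⟩ | ⟨-, hi | hi | hi⟩
            · rw [e, phi_simple, map_zero]
            · exfalso
              have := hM.form_cases (hM.add_pos hw hw1) i
              rw [form_add_simple, gram_three h', hi] at this
              omega
            · rw [phi_zero hw hi, map_smul, hlow j hw hwv, smul_zero]
            · have hx := hM.sub_pos hw hi
              rw [phi_down hw hi, map_smul, ih _ hx, smul_zero]
              have e1 : ∑ k, (v - simpleRoot j - simpleRoot i) k = ∑ k, v k - 1 - 1 := by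
                simp only [Pi.sub_apply, Finset.sum_sub_distrib, ht]
              push_cast at hn
              omega
          rw [h0] at this
          exact (P.c.isUnit.smul_eq_zero).1 this
      intro i
      by_cases hvs : ∃ j, v = simpleRoot j
      · obtain ⟨j, rfl⟩ := hvs
        exact hs i j
      push Not at hvs
      obtain ⟨j, hj⟩ := hpos v hv
      have hj1 : form M v (simpleRoot j) = 1 := by
        rcases hM.form_cases hv j with h | h
        · exact absurd h.1 (hvs j)
        · omega
      by_cases hij : i = j
      swap
      · exact hne i j hij hj1
      subst hij
      have hw := hM.sub_pos hv hj1
      have hwv := sub_add_cancel v (simpleRoot i)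
      have hwi : form M (v - simpleRoot i) (simpleRoot i) = -1 := by
        rw [form_sub_simple, gram_self, hj1]; norm_num
      obtain ⟨k, hk⟩ := hpos _ hw
      have hki : i ≠ k := by rintro rfl; omega
      rw [form_sub_simple] at hk
      rcases hM.small i k hki with h | h
      · rw [gram_two h, sub_zero] at hk
        refine hne i k hki ?_
        rcases hM.form_cases hv k with h | h
        · exact absurd h.1 (hvs k)
        · omega
      have h' : M k i = 3 := by rw [M.symmetric, h]
      rw [gram_three h] at hk
      rcases hM.form_cases hv k with h1 | ⟨-, h1 | h1 | h1⟩
      · exact absurd h1.1 (hvs k)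
      · omega
      · have := LinearMap.congr_fun (hf.braid i k h) (basisVec M R v)
        rw [LinearMap.comp_apply, LinearMap.comp_apply, phi_zero hv h1, phi_down hv hj1, map_smul,
          map_smul, hlow i hw hwv, smul_zero] at this
        exact (P.d.isUnit.smul_eq_zero).1 this
      · exact hne i k hki h1
  refine lk_ext fun v hv => ?_
  rw [LinearMap.zero_apply]
  refine key (∑ k, v k).toNat v hv ?_ i
  exact Int.self_le_toNat _

variable (M)

/-- The group of automorphisms of a Coxeter matrix. -/
def coxeterAut : Subgroup (Equiv.Perm I) where
  carrier := {g | ∀ i j, M (g i) (g j) = M i j}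
  one_mem' := fun _ _ => rfl
  mul_mem' := fun {g h} hg hh i j => by
    rw [Equiv.Perm.mul_apply, Equiv.Perm.mul_apply, hg, hh]
  inv_mem' := fun {g} hg i j => by
    have := hg (g⁻¹ i) (g⁻¹ j)
    simpa using this.symm

variable {M}

/-- The action of a permutation of the simple roots on the lattice they span. -/
def permLattice (g : Equiv.Perm I) (v : I → ℤ) : I → ℤ := fun i => v (g.symm i)

theorem permLattice_simple (g : Equiv.Perm I) (i : I) :
    permLattice g (simpleRoot i) = simpleRoot (g i) := by
  ext j
  simp [permLattice, simpleRoot, Pi.single_apply, Equiv.symm_apply_eq]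

theorem gram_aut (g : coxeterAut M) (i j : I) : gram M (g.1 i) (g.1 j) = gram M i j := by
  simp [gram, g.2 i j]

theorem form_permLattice (g : coxeterAut M) (v w : I → ℤ) :
    form M (permLattice g.1 v) (permLattice g.1 w) = form M v w := by
  simp only [form, Matrix.toBilin'_apply]
  rw [← Equiv.sum_comp g.1]
  refine Finset.sum_congr rfl fun i _ => ?_
  rw [← Equiv.sum_comp g.1]
  refine Finset.sum_congr rfl fun j _ => ?_
  simp [permLattice, gram_aut]

theorem permLattice_reflect (g : coxeterAut M) (i : I) (v : I → ℤ) :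
    permLattice g.1 (reflect M i v) = reflect M (g.1 i) (permLattice g.1 v) := by
  have h := form_permLattice g v (simpleRoot i)
  rw [permLattice_simple] at h
  rw [reflect, reflect, h, ← permLattice_simple]
  rfl

theorem isPosRoot_permLattice (g : coxeterAut M) {v : I → ℤ} (hv : IsPosRoot M v) :
    IsPosRoot M (permLattice g.1 v) := by
  refine ⟨?_, fun i => hv.2 (g.1.symm i)⟩
  have h := hv.1
  clear hv
  induction h with
  | simple i => rw [permLattice_simple]; exact .simple _
  | reflect i v _ ih => rw [permLattice_reflect]; exact .reflect _ _ ih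

/-- The permutation of the positive roots induced by an automorphism of the Coxeter matrix. -/
def permRoot (g : coxeterAut M) : Equiv.Perm (PosRoot M) where
  toFun v := ⟨permLattice g.1 v.1, isPosRoot_permLattice g v.2⟩
  invFun v := ⟨permLattice g⁻¹.1 v.1, isPosRoot_permLattice g⁻¹ v.2⟩
  left_inv v := Subtype.ext (funext fun i => congrArg v.1 (g.1.symm_apply_apply i))
  right_inv v := Subtype.ext (funext fun i => congrArg v.1 (g.1.apply_symm_apply i))

/-- The action of an automorphism of the Coxeter matrix on `V`, by permutation of the basis. -/
noncomputable def actModule (R : Type*) [CommRing R] (g : coxeterAut M) :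
    LKModule M R ≃ₗ[R] LKModule M R :=
  Finsupp.domLCongr (permRoot g)

/-- The submodule `V ^ G` of fixed points. -/
def fixedModule (R : Type*) [CommRing R] (G : Subgroup (coxeterAut M)) :
    Submodule R (LKModule M R) where
  carrier := {x | ∀ g ∈ G, actModule R g x = x}
  zero_mem' := fun g _ => map_zero _
  add_mem' := fun {x y} hx hy g hg => by rw [map_add, hx g hg, hy g hg]
  smul_mem' := fun r x hx g hg => by rw [map_smul, hx g hg]

/-- The action of an automorphism of the Coxeter matrix on the Artin-Tits group. -/
def actArtin (g : coxeterAut M) : ArtinGroup M →* ArtinGroup M :=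
  artinLift M (fun i => gen M (g.1 i)) fun i j => by
    have := gen_rel M (g.1 i) (g.1 j)
    rwa [g.2 i j] at this

theorem actArtin_gen (g : coxeterAut M) (i : I) : actArtin g (gen M i) = gen M (g.1 i) :=
  artinLift_gen _ _ _ _

/-- The subgroup `B ^ G` of fixed points of the Artin-Tits group. -/
def fixedArtin (G : Subgroup (coxeterAut M)) : Subgroup (ArtinGroup M) where
  carrier := {w | ∀ g ∈ G, actArtin g w = w}
  one_mem' := fun g _ => map_one _
  mul_mem' := fun {x y} hx hy g hg => by rw [map_mul, hx g hg, hy g hg]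
  inv_mem' := fun {x} hx g hg => by rw [map_inv, hx g hg]

theorem actModule_basis (g : coxeterAut M) {v : I → ℤ} (hv : IsPosRoot M v) :
    actModule R g (basisVec M R v) = basisVec M R (permLattice g.1 v) := by
  rw [basisVec_of_pos hv, basisVec_of_pos (isPosRoot_permLattice g hv), actModule,
    Finsupp.domLCongr_single]
  rfl

theorem actModule_phi (hM : IsADE M) (g : coxeterAut M) (i : I) (x : LKModule M R) :
    actModule R g (phi M P i x) = phi M P (g.1 i) (actModule R g x) := by
  have : (actModule R g).toLinearMap ∘ₗ phi M P i =
      phi M P (g.1 i) ∘ₗ (actModule R g).toLinearMap := by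
    refine lk_ext fun v hv => ?_
    simp only [LinearMap.comp_apply, LinearEquiv.coe_coe]
    rw [actModule_basis g hv]
    have hf : form M (permLattice g.1 v) (simpleRoot (g.1 i)) = form M v (simpleRoot i) := by
      rw [← permLattice_simple, form_permLattice]
    rcases hM.form_cases hv i with ⟨rfl, hi⟩ | ⟨-, hi | hi | hi⟩
    · rw [phi_simple, permLattice_simple, phi_simple, map_zero]
    · rw [phi_up hv hi, phi_up (isPosRoot_permLattice g hv) (hf.trans hi), map_add, map_smul,
        map_smul, actModule_basis g hv, actModule_basis g (hM.add_pos hv hi),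
        ← permLattice_simple]
      rfl
    · rw [phi_zero hv hi, phi_zero (isPosRoot_permLattice g hv) (hf.trans hi), map_smul,
        actModule_basis g hv]
    · rw [phi_down hv hi, phi_down (isPosRoot_permLattice g hv) (hf.trans hi), map_smul,
        actModule_basis g (hM.sub_pos hv hi), ← permLattice_simple]
      rfl
  exact LinearMap.congr_fun this x

/-- An LK-family of an `ADE` type is invariant under the automorphisms of the Coxeter matrix. -/
theorem IsLKFamily.aut (hM : IsADE M) (hf : IsLKFamily M P f) (g : coxeterAut M) (i : I)
    (x : LKModule M R) : f (g.1 i) (actModule R g x) = f i x := by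
  have hc : ∀ i j, f i (basisVec M R (simpleRoot i)) = f j (basisVec M R (simpleRoot j)) := by
    intro i j
    induction hM.connected i j with
    | refl => rfl
    | @tail k l _ h ih =>
      rw [ih]
      have h' : M l k = 3 := by rw [M.symmetric, h]
      have gl : form M (simpleRoot k) (simpleRoot l) = -1 := by rw [form_simple, gram_three h]
      have hp := hM.add_pos (isPosRoot_simpleRoot k) gl
      have := LinearMap.congr_fun (hf.braid k l h)
        (basisVec M R (simpleRoot k + simpleRoot l))
      rw [LinearMap.comp_apply, LinearMap.comp_apply,
        phi_down hp (by rw [form_add_simple, gram_self, gl]; norm_num : _ = (1 : ℤ)),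
        phi_down hp (by rw [form_add_simple, form_simple_self, gram_three h']; norm_num :
          form M (simpleRoot k + simpleRoot l) (simpleRoot k) = 1),
        add_sub_cancel_right, add_sub_cancel_left, map_smul, map_smul] at this
      exact P.b.isUnit.smul_left_cancel.1 this
  let f' : I → Module.Dual R (LKModule M R) := fun i =>
    f (g.1 i) ∘ₗ (actModule R g).toLinearMap - f i
  have hf' : IsLKFamily M P f' := by
    refine ⟨fun i j hij => ?_, fun i j h => ?_, fun i j h => ?_⟩
    · simp only [f', LinearMap.sub_apply, LinearMap.comp_apply, LinearEquiv.coe_coe]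
      rw [actModule_basis g (isPosRoot_simpleRoot j), permLattice_simple, hf.simple i j hij,
        hf.simple _ _ (g.1.injective.ne hij), sub_zero]
    · refine LinearMap.ext fun y => ?_
      have h1 := LinearMap.congr_fun (hf.comm i j h) y
      have h2 := LinearMap.congr_fun (hf.comm (g.1 i) (g.1 j) ((g.2 i j).trans h))
        (actModule R g y)
      simp only [LinearMap.comp_apply, LinearMap.smul_apply] at h1 h2
      simp only [f', LinearMap.sub_apply, LinearMap.comp_apply, LinearEquiv.coe_coe,
        LinearMap.smul_apply, actModule_phi hM, h1, h2, smul_sub]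
    · refine LinearMap.ext fun y => ?_
      have h1 := LinearMap.congr_fun (hf.braid i j h) y
      have h2 := LinearMap.congr_fun (hf.braid (g.1 i) (g.1 j) ((g.2 i j).trans h))
        (actModule R g y)
      simp only [LinearMap.comp_apply] at h1 h2
      simp only [f', LinearMap.sub_apply, LinearMap.comp_apply, LinearEquiv.coe_coe,
        actModule_phi hM, h1, h2]
  have h0 := hf'.eq_zero hM (fun i => by
    simp only [f', LinearMap.sub_apply, LinearMap.comp_apply, LinearEquiv.coe_coe]
    rw [actModule_basis g (isPosRoot_simpleRoot i), permLattice_simple, hc (g.1 i) i, sub_self]) i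
  have := LinearMap.congr_fun h0 x
  simpa [f', sub_eq_zero] using this

theorem actModule_psi (hM : IsADE M) (hf : IsLKFamily M P f) (g : coxeterAut M) (i : I)
    (x : LKModule M R) :
    actModule R g (psi M P f i x) = psi M P f (g.1 i) (actModule R g x) := by
  rw [psi_apply, psi_apply, map_add, map_smul, actModule_phi hM, hf.aut hM,
    actModule_basis g (isPosRoot_simpleRoot i), permLattice_simple]

theorem actModule_lkRep (hM : IsADE M) (F : LKFamilyGr M P) (g : coxeterAut M)
    (w : ArtinGroup M) (x : LKModule M R) :
    actModule R g (lkRep hM F w x) = lkRep hM F (actArtin g w) (actModule R g x) := by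
  have hw : w ∈ Subgroup.closure (Set.range (gen M)) := by
    have := PresentedGroup.closure_range_of (artinRels M)
    exact this ▸ Subgroup.mem_top w
  induction hw using Subgroup.closure_induction generalizing x with
  | mem w h =>
    obtain ⟨i, rfl⟩ := h
    rw [actArtin_gen, lkRep_gen, lkRep_gen, actModule_psi hM F.isLKFamily]
  | one => simp
  | mul a b _ _ ha hb => simp only [map_mul, Module.End.mul_apply, ha, hb]
  | inv a _ ha =>
    have h := ha (lkRep hM F a⁻¹ x)
    rw [Representation.self_inv_apply] at h
    rw [map_inv (actArtin g), h, Representation.inv_self_apply]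

/-- The twisted LK-representation `ψ ^ G` of `B ^ G` on `V ^ G`: the restriction of `ψ`. -/
noncomputable def twistedLKRep (hM : IsADE M) (G : Subgroup (coxeterAut M))
    (F : LKFamilyGr M P) : Representation R (fixedArtin G) (fixedModule R G) :=
  Representation.subrepresentation ((lkRep hM F).comp (fixedArtin G).subtype) (fixedModule R G)
    fun w x hx g hg => by
      have h1 : actArtin g w.1 = w.1 := w.2 g hg
      have h2 : actModule R g x = x := hx g hg
      have h := actModule_lkRep hM F g w.1 x
      rw [h1, h2] at h
      exact h

end RootSystem

section TypeB

/-- The Coxeter matrix of type `D (n + 1)`, for `n ≥ 2`. In the usual labelling `1, …, n + 1` of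
the vertices (here shifted to `0, …, n`), the two vertices `n` and `n + 1` are both joined to
`n - 1`. -/
def typeD (n : ℕ) : CoxeterMatrix (Fin (n + 1)) where
  M := Matrix.of fun i j : Fin (n + 1) =>
    if i = j then 1
    else if ((i : ℕ) + 1 = j ∧ (j : ℕ) < n) ∨ ((j : ℕ) + 1 = i ∧ (i : ℕ) < n) ∨
      ((i : ℕ) + 2 = n ∧ (j : ℕ) = n) ∨ ((j : ℕ) + 2 = n ∧ (i : ℕ) = n) then 3
    else 2
  isSymm := by
    ext i j
    simp only [Matrix.transpose_apply, Matrix.of_apply, Fin.ext_iff]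
    split_ifs <;> omega
  diagonal := by simp
  off_diagonal := by
    intro i j h
    simp only [Matrix.of_apply, h, if_false]
    split_ifs <;> omega

theorem typeA_apply {m : ℕ} (i j : Fin m) : CoxeterMatrix.A m i j =
    if (i : ℕ) = j then 1 else if (j : ℕ) + 1 = i ∨ (i : ℕ) + 1 = j then 3 else 2 := by
  simp [CoxeterMatrix.A, Fin.ext_iff]

theorem typeB_apply {n : ℕ} (i j : Fin n) : CoxeterMatrix.B n i j =
    if (i : ℕ) = j then 1
    else if (i : ℕ) = n - 1 ∧ (j : ℕ) = n - 2 ∨ (j : ℕ) = n - 1 ∧ (i : ℕ) = n - 2 then 4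
    else if (j : ℕ) + 1 = i ∨ (i : ℕ) + 1 = j then 3 else 2 := by
  simp [CoxeterMatrix.B, Fin.ext_iff]

theorem typeD_apply {n : ℕ} (i j : Fin (n + 1)) : typeD n i j =
    if (i : ℕ) = j then 1
    else if ((i : ℕ) + 1 = j ∧ (j : ℕ) < n) ∨ ((j : ℕ) + 1 = i ∧ (i : ℕ) < n) ∨
      ((i : ℕ) + 2 = n ∧ (j : ℕ) = n) ∨ ((j : ℕ) + 2 = n ∧ (i : ℕ) = n) then 3
    else 2 := by
  simp [typeD, Fin.ext_iff]

theorem posDef_of_realization {I N : Type*} [Fintype I] [DecidableEq I] [Fintype N]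
    {M : CoxeterMatrix I} (a u : I → N → ℤ) (h1 : ∀ i j, a i ⬝ᵥ a j = gram M i j)
    (h2 : ∀ i j, a i ⬝ᵥ u j = if i = j then 2 else 0) (v : I → ℤ) (hv : v ≠ 0) :
    0 < form M v v := by
  have e : form M v v = (∑ i, v i • a i) ⬝ᵥ (∑ i, v i • a i) := by
    simp only [form, Matrix.toBilin'_apply, sum_dotProduct, dotProduct_sum, smul_dotProduct,
      dotProduct_smul, h1, smul_eq_mul]
    refine Finset.sum_congr rfl fun i _ => ?_
    rw [Finset.mul_sum]
    refine Finset.sum_congr rfl fun j _ => ?_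
    rw [gram_symm]
    ring
  rw [e]
  refine lt_of_le_of_ne (Finset.sum_nonneg fun i _ => mul_self_nonneg _) fun h => hv ?_
  have h0 := dotProduct_self_eq_zero.1 h.symm
  ext j
  have : (∑ i, v i • a i) ⬝ᵥ u j = 2 * v j := by
    simp only [sum_dotProduct, smul_dotProduct, h2, smul_eq_mul, mul_ite, mul_zero,
      Finset.sum_ite_eq', Finset.mem_univ, if_true]
    ring
  rw [h0, zero_dotProduct] at this
  simp only [Pi.zero_apply]
  omega

theorem isADE_typeA (m : ℕ) : IsADE (CoxeterMatrix.A m) where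
  small i j h := by
    rw [typeA_apply]
    have := Fin.val_ne_of_ne h
    split_ifs <;> simp_all
  posDef := by
    refine posDef_of_realization (N := Fin (m + 1))
      (fun i => Pi.single i.castSucc 1 - Pi.single i.succ 1)
      (fun i k => if (k : ℕ) ≤ i then 2 else 0) (fun i j => ?_) (fun i j => ?_)
    · simp only [sub_dotProduct, single_dotProduct, Pi.sub_apply, Pi.single_apply, gram,
        Matrix.of_apply, typeA_apply, Fin.ext_iff, Fin.val_castSucc, Fin.val_succ]
      split_ifs <;> omega
    · simp only [sub_dotProduct, single_dotProduct, Fin.ext_iff, Fin.val_castSucc, Fin.val_succ]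
      split_ifs <;> omega
  connected := by
    have key : ∀ k (hk : k < m), ∀ l (hl : l < m), Relation.ReflTransGen
        (fun k l => CoxeterMatrix.A m k l = 3) ⟨k, hk⟩ ⟨l, hl⟩ := by
      intro k hk
      have h0 : Relation.ReflTransGen
        (fun k l => CoxeterMatrix.A m k l = 3) ⟨k, hk⟩ ⟨0, by omega⟩ := by
        induction k with
        | zero => exact .refl
        | succ k ih => exact .head (by simp [typeA_apply]) (ih (by omega))
      intro l
      induction l with
      | zero => exact fun _ => h0
      | succ l ih => exact fun hl => .tail (ih (by omega)) (by simp [typeA_apply])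
    exact fun i j => key i i.2 j j.2

theorem isADE_typeD {n : ℕ} (hn : 3 ≤ n) : IsADE (typeD n) where
  small i j h := by
    rw [typeD_apply]
    have := Fin.val_ne_of_ne h
    split_ifs <;> simp_all
  posDef := by
    refine posDef_of_realization (N := Fin (n + 1))
      (fun i => if h : (i : ℕ) < n then Pi.single i 1 - Pi.single ⟨i + 1, by omega⟩ 1
        else Pi.single ⟨n - 1, by omega⟩ 1 + Pi.single (Fin.last n) 1)
      (fun i k => if (i : ℕ) + 1 < n then (if (k : ℕ) ≤ i then 2 else 0)
        else if (i : ℕ) < n ∧ (k : ℕ) = n then -1 else 1) (fun i j => ?_) (fun i j => ?_)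
    · have hi := i.2
      have hj := j.2
      by_cases h1 : (i : ℕ) < n <;> by_cases h2 : (j : ℕ) < n <;>
      simp only [h1, h2, dif_pos, dif_neg, not_false_eq_true, sub_dotProduct, add_dotProduct,
        single_dotProduct, Pi.sub_apply, Pi.add_apply, Pi.single_apply, gram,
        Matrix.of_apply, typeD_apply, Fin.ext_iff, Fin.val_last, if_true, and_true, and_false,
        false_or] <;>
      split_ifs <;> omega
    · have hi := i.2
      have hj := j.2
      by_cases h1 : (i : ℕ) < n <;>
      simp only [h1, dif_pos, dif_neg, not_false_eq_true, sub_dotProduct, add_dotProduct,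
        single_dotProduct, Fin.ext_iff, Fin.val_last, and_true] <;>
      split_ifs <;> omega
  connected := by
    have h0 : ∀ k (hk : k < n + 1), Relation.ReflTransGen
        (fun k l => typeD n k l = 3) ⟨k, hk⟩ ⟨0, by omega⟩ := by
      intro k
      induction k using Nat.strong_induction_on with
      | _ k ih =>
        intro hk
        rcases Nat.eq_zero_or_pos k with rfl | h
        · exact .refl
        by_cases hkn : k = n
        · refine .head (b := ⟨n - 2, by omega⟩) ?_ (ih (n - 2) (by omega) (by omega))
          rw [typeD_apply]
          simp only
          rw [if_neg (by omega), if_pos (by omega)]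
        · refine .head (b := ⟨k - 1, by omega⟩) ?_ (ih (k - 1) (by omega) (by omega))
          rw [typeD_apply]
          simp only
          rw [if_neg (by omega), if_pos (by omega)]
    intro i j
    refine (h0 i i.2).trans ?_
    have hsymm : Std.Symm (fun k l => typeD n k l = 3) :=
      ⟨fun k l h => by rw [(typeD n).symmetric, h]⟩
    exact Relation.ReflTransGen.stdSymm.symm _ _ (h0 j j.2)

/-- The nontrivial automorphism of the Coxeter graph of type `A m`. -/
def flipA (m : ℕ) : coxeterAut (CoxeterMatrix.A m) :=
  ⟨Fin.revPerm, fun i j => by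
    simp only [typeA_apply, Fin.revPerm_apply, Fin.val_rev]
    have := i.2
    have := j.2
    split_ifs <;> omega⟩

/-- The automorphism of the Coxeter graph of type `D (n + 1)` that exchanges the two end
vertices `n` and `n + 1` of the fork. -/
def flipD (n : ℕ) : coxeterAut (typeD n) :=
  ⟨Equiv.swap ⟨n - 1, by omega⟩ (Fin.last n), fun i j => by
    have hval : ∀ k : Fin (n + 1), ((Equiv.swap ⟨n - 1, by omega⟩ (Fin.last n) k : Fin (n + 1)) : ℕ)
        = if (k : ℕ) = n - 1 then n else if (k : ℕ) = n then n - 1 else k := by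
      intro k
      rw [Equiv.swap_apply_def]
      simp only [Fin.ext_iff, Fin.val_last]
      split_ifs <;> rfl
    have := i.2
    have := j.2
    simp only [typeD_apply, hval]
    split_ifs <;> omega⟩

/-- The group of order two of automorphisms of the Coxeter graph of type `A m`, `m ≥ 2`: it is the
full automorphism group. -/
def groupA (m : ℕ) : Subgroup (coxeterAut (CoxeterMatrix.A m)) := Subgroup.zpowers (flipA m)

/-- The group of order two of automorphisms of the Coxeter graph of type `D (n + 1)` generated by
the exchange of the two end vertices of the fork (the full automorphism group if `n ≥ 4`). -/
def groupD (n : ℕ) : Subgroup (coxeterAut (typeD n)) := Subgroup.zpowers (flipD n)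

theorem mem_fixedArtin_zpowers {I : Type*} [Fintype I] [DecidableEq I] {M : CoxeterMatrix I}
    {g : coxeterAut M} {w : ArtinGroup M} (h : actArtin g w = w) :
    w ∈ fixedArtin (Subgroup.zpowers g) := by
  have hm : ∀ g h : coxeterAut M, ∀ w, actArtin (g * h) w = actArtin g (actArtin h w) := by
    intro g h w
    have : actArtin (g * h) = (actArtin g).comp (actArtin h) :=
      PresentedGroup.ext fun i => by
        change actArtin (g * h) (gen M i) = actArtin g (actArtin h (gen M i))
        simp only [actArtin_gen]
        rfl
    rw [this]; rfl
  have h1 : ∀ w, actArtin (1 : coxeterAut M) w = w := by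
    intro w
    have : actArtin (1 : coxeterAut M) = MonoidHom.id _ :=
      PresentedGroup.ext fun i => actArtin_gen 1 i
    rw [this]; rfl
  let S : Subgroup (coxeterAut M) :=
    { carrier := {k | actArtin k w = w}
      one_mem' := h1 w
      mul_mem' := fun {a b} ha hb => by
        change actArtin (a * b) w = w
        rw [hm, hb, ha]
      inv_mem' := fun {a} ha => by
        change actArtin a⁻¹ w = w
        conv_lhs => rw [← (show actArtin a w = w from ha)]
        rw [← hm, inv_mul_cancel, h1] }
  exact fun k hk => (Subgroup.zpowers_le.2 (show g ∈ S from h)) hk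

theorem gen_comm {I : Type*} {M : CoxeterMatrix I} {i j : I} (h : M i j = 2) :
    gen M i * gen M j = gen M j * gen M i := by
  have := gen_rel M i j
  rw [h] at this
  simpa [altProd] using this

theorem gen_braid {I : Type*} {M : CoxeterMatrix I} {i j : I} (h : M i j = 3) :
    gen M i * gen M j * gen M i = gen M j * gen M i * gen M j := by
  have := gen_rel M i j
  rw [h] at this
  simpa [altProd, mul_assoc] using this

theorem pair_braid {G : Type*} [Group G] {x y z w : G} (hxy : x * y * x = y * x * y)
    (hzw : z * w * z = w * z * w) (hxz : x * z = z * x) (hxw : x * w = w * x)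
    (hyz : y * z = z * y) (hyw : y * w = w * y) :
    (x * z) * (y * w) * (x * z) = (y * w) * (x * z) * (y * w) := by
  calc (x * z) * (y * w) * (x * z) = x * (z * y) * w * (x * z) := by group
    _ = x * y * z * (w * x) * z := by rw [← hyz]; group
    _ = x * y * (z * x) * w * z := by rw [← hxw]; group
    _ = (x * y * x) * (z * w * z) := by rw [← hxz]; group
    _ = y * x * (y * w) * z * w := by rw [hxy, hzw]; group
    _ = y * (x * w) * (y * z) * w := by rw [hyw]; group
    _ = (y * w) * (x * z) * (y * w) := by rw [hxw, hyz]; group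

theorem four_braid {G : Type*} [Group G] {x y z : G} (hxy : x * y * x = y * x * y)
    (hzy : z * y * z = y * z * y) (hxz : x * z = z * x) :
    (x * z) * y * (x * z) * y = y * (x * z) * y * (x * z) := by
  calc (x * z) * y * (x * z) * y = (x * z) * y * (z * x) * y := by rw [hxz]
    _ = x * (z * y * z) * x * y := by group
    _ = x * y * z * (y * x * y) := by rw [hzy]; group
    _ = x * y * (z * x) * y * x := by rw [← hxy]; group
    _ = (x * y * x) * z * y * x := by rw [← hxz]; group
    _ = y * x * (y * z * y) * x := by rw [hxy]; group
    _ = y * (x * z) * y * (z * x) := by rw [← hzy]; group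
    _ = y * (x * z) * y * (x * z) := by rw [hxz]

theorem four_braid' {G : Type*} [Group G] {x y z w : G} (hxy : x * y * x = y * x * y)
    (hyz : y * z * y = z * y * z) (hzw : z * w * z = w * z * w) (hxz : x * z = z * x)
    (hxw : x * w = w * x) (hyw : y * w = w * y) :
    (x * w) * (y * z * y) * (x * w) * (y * z * y) =
      (y * z * y) * (x * w) * (y * z * y) * (x * w) := by
  have hE : (x * w) * (y * z * y) * (x * w) = x * y * z * w * z * y * x := by
    calc (x * w) * (y * z * y) * (x * w) = x * (w * y) * z * y * (x * w) := by group
      _ = x * y * w * z * (y * w) * x := by rw [← hyw, hxw]; group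
      _ = x * y * (w * z * w) * y * x := by rw [hyw]; group
      _ = x * y * z * w * z * y * x := by rw [← hzw]; group
  have h1 : y * (x * y * z * w * z * y * x) = (x * y * z * w * z * y * x) * y := by
    calc y * (x * y * z * w * z * y * x) = (y * x * y) * z * w * z * y * x := by group
      _ = x * y * (x * z) * w * z * y * x := by rw [← hxy]; group
      _ = x * y * z * (x * w) * z * y * x := by rw [hxz]; group
      _ = x * y * z * w * (x * z) * y * x := by rw [hxw]; group
      _ = x * y * z * w * z * (x * y * x) := by rw [hxz]; group
      _ = (x * y * z * w * z * y * x) * y := by rw [hxy]; group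
  have h2 : z * (x * y * z * w * z * y * x) = (x * y * z * w * z * y * x) * z := by
    calc z * (x * y * z * w * z * y * x) = (z * x) * y * z * w * z * y * x := by group
      _ = x * (z * y * z) * w * z * y * x := by rw [← hxz]; group
      _ = x * y * z * (y * w) * z * y * x := by rw [← hyz]; group
      _ = x * y * z * w * (y * z * y) * x := by rw [hyw]; group
      _ = x * y * z * w * z * y * (z * x) := by rw [hyz]; group
      _ = (x * y * z * w * z * y * x) * z := by rw [← hxz]; group
  rw [hE]
  have h1' : Commute y (x * y * z * w * z * y * x) := h1
  have h2' : Commute z (x * y * z * w * z * y * x) := h2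
  have h3 := ((h1'.mul_left h2').mul_left h1').eq
  rw [← h3, ← hE]
  group



theorem typeB_rel {G : Type*} [Group G] {n : ℕ} (x : Fin n → G)
    (hc : ∀ i j : Fin n, (i : ℕ) + 2 ≤ j → x i * x j = x j * x i)
    (hb : ∀ i j : Fin n, (i : ℕ) + 1 = j → (j : ℕ) + 1 < n → x i * x j * x i = x j * x i * x j)
    (hf : ∀ i j : Fin n, (i : ℕ) + 1 = j → (j : ℕ) + 1 = n →
      x i * x j * x i * x j = x j * x i * x j * x i) (i j : Fin n) :
    altProd (x i) (x j) (CoxeterMatrix.B n i j) = altProd (x j) (x i) (CoxeterMatrix.B n i j) := by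
  have key : ∀ i j : Fin n, (i : ℕ) < j → altProd (x i) (x j) (CoxeterMatrix.B n i j) =
      altProd (x j) (x i) (CoxeterMatrix.B n i j) := by
    intro i j hij
    have := i.2
    have := j.2
    rw [typeB_apply, if_neg (by omega)]
    by_cases h1 : (i : ℕ) + 1 = j
    · by_cases h2 : (j : ℕ) + 1 = n
      · rw [if_pos (by omega)]
        simpa [altProd, mul_assoc] using hf i j h1 h2
      · rw [if_neg (by omega), if_pos (by omega)]
        simpa [altProd, mul_assoc] using hb i j h1 (by omega)
    · rw [if_neg (by omega), if_neg (by omega)]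
      simpa [altProd] using hc i j (by omega)
  rcases lt_trichotomy (i : ℕ) j with h | h | h
  · exact key i j h
  · rw [Fin.ext h]
  · rw [(CoxeterMatrix.B n).symmetric, key j i h]

/-- The homomorphism from the Artin-Tits group of type `B n` to the fixed subgroup of another
Artin-Tits group, determined by the images of the standard generators. -/
def liftFixed {n : ℕ} {I : Type*} [Fintype I] [DecidableEq I] {M : CoxeterMatrix I}
    {g : coxeterAut M} (x : Fin n → ArtinGroup M) (hg : ∀ i, actArtin g (x i) = x i)
    (h : ∀ i j, altProd (x i) (x j) (CoxeterMatrix.B n i j) =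
      altProd (x j) (x i) (CoxeterMatrix.B n i j)) :
    ArtinGroup (CoxeterMatrix.B n) →* fixedArtin (Subgroup.zpowers g) :=
  artinLift (CoxeterMatrix.B n) (fun i => ⟨x i, mem_fixedArtin_zpowers (hg i)⟩) fun i j => by
    apply (fixedArtin (Subgroup.zpowers g)).subtype_injective
    rw [map_altProd, map_altProd]
    exact h i j

/-- The image of the `i`-th standard generator of the Artin-Tits group of type `B n` in the one of
type `A (2 n - 1)`. In the labelling from `1`, it is `s i * s (2 n - i)` for `i < n`, and `s n`
for `i = n`. -/
def deltaAodd (n : ℕ) (i : Fin n) : ArtinGroup (CoxeterMatrix.A (2 * n - 1)) :=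
  if (i : ℕ) + 1 < n then
    gen _ (⟨i, by omega⟩ : Fin (2 * n - 1)) * gen _ (⟨2 * n - 2 - i, by omega⟩ : Fin (2 * n - 1))
  else gen _ (⟨i, by omega⟩ : Fin (2 * n - 1))

/-- The image of the `i`-th standard generator of the Artin-Tits group of type `B n` in the one of
type `A (2 n)`. In the labelling from `1`, it is `s i * s (2 n + 1 - i)` for `i < n`, and
`s n * s (n + 1) * s n` for `i = n`. -/
def deltaAeven (n : ℕ) (i : Fin n) : ArtinGroup (CoxeterMatrix.A (2 * n)) :=
  if (i : ℕ) + 1 < n then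
    gen _ (⟨i, by omega⟩ : Fin (2 * n)) * gen _ (⟨2 * n - 1 - i, by omega⟩ : Fin (2 * n))
  else gen _ (⟨i, by omega⟩ : Fin (2 * n)) * gen _ (⟨2 * n - 1 - i, by omega⟩ : Fin (2 * n)) *
    gen _ (⟨i, by omega⟩ : Fin (2 * n))

/-- The image of the `i`-th standard generator of the Artin-Tits group of type `B n` in the one of
type `D (n + 1)`. In the labelling from `1`, it is `s i` for `i < n`, and `s n * s (n + 1)` for
`i = n`. -/
def deltaD (n : ℕ) (i : Fin n) : ArtinGroup (typeD n) :=
  if (i : ℕ) + 1 < n then gen _ i.castSucc else gen _ i.castSucc * gen _ (Fin.last n)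

theorem genA_comm {m : ℕ} (i j : Fin m) (h : (i : ℕ) + 2 ≤ j ∨ (j : ℕ) + 2 ≤ i) :
    gen (CoxeterMatrix.A m) i * gen _ j = gen _ j * gen _ i := by
  apply gen_comm
  rw [typeA_apply, if_neg (by omega), if_neg (by omega)]

theorem genA_braid {m : ℕ} (i j : Fin m) (h : (i : ℕ) + 1 = j ∨ (j : ℕ) + 1 = i) :
    gen (CoxeterMatrix.A m) i * gen _ j * gen _ i = gen _ j * gen _ i * gen _ j := by
  apply gen_braid
  rw [typeA_apply, if_neg (by omega), if_pos (by omega)]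

theorem actArtin_flipA {m : ℕ} (i j : Fin m) (h : (i : ℕ) + j + 1 = m) :
    actArtin (flipA m) (gen _ i) = gen _ j := by
  rw [actArtin_gen]
  congr 1
  ext
  simp only [flipA, Fin.revPerm_apply, Fin.val_rev]
  omega

/-- The Artin-Tits group of type `B n` as fixed subgroup of the one of type `A (2 n - 1)`. -/
def embedAodd (n : ℕ) : ArtinGroup (CoxeterMatrix.B n) →* fixedArtin (groupA (2 * n - 1)) :=
  liftFixed (deltaAodd n) (fun i => by
    have hi := i.2
    by_cases h : (i : ℕ) + 1 < n
    · simp only [deltaAodd, h, if_true, map_mul]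
      rw [actArtin_flipA _ ⟨2 * n - 2 - i, by omega⟩ (by simp only; omega),
        actArtin_flipA _ ⟨i, by omega⟩ (by simp only; omega)]
      exact genA_comm _ _ (by simp only; omega)
    · simp only [deltaAodd, h, if_false]
      exact actArtin_flipA _ _ (by simp only; omega)) (by
    refine typeB_rel _ (fun i j h => ?_) (fun i j h h' => ?_) (fun i j h h' => ?_)
    · have hj := j.2
      by_cases h' : (j : ℕ) + 1 < n
      · simp only [deltaAodd, h', show (i : ℕ) + 1 < n by omega, if_true]
        refine ((Commute.mul_left ?_ ?_).mul_right (Commute.mul_left ?_ ?_)).eq <;>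
        exact genA_comm _ _ (by simp only; omega)
      · simp only [deltaAodd, h', show (i : ℕ) + 1 < n by omega, if_true, if_false]
        refine (Commute.mul_left ?_ ?_).eq <;>
        exact genA_comm _ _ (by simp only; omega)
    · simp only [deltaAodd, h', show (i : ℕ) + 1 < n by omega, if_true]
      apply pair_braid
      · exact genA_braid _ _ (by simp only; omega)
      · exact genA_braid _ _ (by simp only; omega)
      all_goals exact genA_comm _ _ (by simp only; omega)
    · simp only [deltaAodd, show ¬ (j : ℕ) + 1 < n by omega, show (i : ℕ) + 1 < n by omega,
        if_true, if_false]
      have := four_braid (x := gen (CoxeterMatrix.A (2 * n - 1)) ⟨i, by omega⟩)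
        (y := gen _ ⟨j, by omega⟩) (z := gen _ ⟨2 * n - 2 - i, by omega⟩)
        (genA_braid _ _ (by simp only; omega)) (genA_braid _ _ (by simp only; omega))
        (genA_comm _ _ (by simp only; omega))
      exact this)

/-- The Artin-Tits group of type `B n` as fixed subgroup of the one of type `A (2 n)`. -/
def embedAeven (n : ℕ) : ArtinGroup (CoxeterMatrix.B n) →* fixedArtin (groupA (2 * n)) :=
  liftFixed (deltaAeven n) (fun i => by
    have hi := i.2
    have h1 := actArtin_flipA (⟨i, by omega⟩ : Fin (2 * n)) ⟨2 * n - 1 - i, by omega⟩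
      (by simp only; omega)
    have h2 := actArtin_flipA (⟨2 * n - 1 - i, by omega⟩ : Fin (2 * n)) ⟨i, by omega⟩
      (by simp only; omega)
    by_cases h : (i : ℕ) + 1 < n
    · simp only [deltaAeven, h, if_true, map_mul]
      rw [h1, h2]
      exact genA_comm _ _ (by simp only; omega)
    · simp only [deltaAeven, h, if_false, map_mul]
      rw [h1, h2]
      exact genA_braid _ _ (by simp only; omega)) (by
    refine typeB_rel _ (fun i j h => ?_) (fun i j h h' => ?_) (fun i j h h' => ?_)
    · have hj := j.2
      by_cases h' : (j : ℕ) + 1 < n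
      · simp only [deltaAeven, h', show (i : ℕ) + 1 < n by omega, if_true]
        refine ((Commute.mul_left ?_ ?_).mul_right (Commute.mul_left ?_ ?_)).eq <;>
        exact genA_comm _ _ (by simp only; omega)
      · simp only [deltaAeven, h', show (i : ℕ) + 1 < n by omega, if_true, if_false]
        refine (((Commute.mul_left ?_ ?_).mul_right (Commute.mul_left ?_ ?_)).mul_right
          (Commute.mul_left ?_ ?_)).eq <;>
        exact genA_comm _ _ (by simp only; omega)
    · simp only [deltaAeven, h', show (i : ℕ) + 1 < n by omega, if_true]
      apply pair_braid
      · exact genA_braid _ _ (by simp only; omega)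
      · exact genA_braid _ _ (by simp only; omega)
      all_goals exact genA_comm _ _ (by simp only; omega)
    · simp only [deltaAeven, show ¬ (j : ℕ) + 1 < n by omega, show (i : ℕ) + 1 < n by omega,
        if_true, if_false]
      apply four_braid'
      · exact genA_braid _ _ (by simp only; omega)
      · exact genA_braid _ _ (by simp only; omega)
      · exact genA_braid _ _ (by simp only; omega)
      all_goals exact genA_comm _ _ (by simp only; omega))

theorem actArtin_flipD_of_lt {n : ℕ} (i : Fin n) (h : (i : ℕ) + 1 < n) :
    actArtin (flipD n) (gen _ i.castSucc) = gen _ i.castSucc := by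
  rw [actArtin_gen]
  congr 1
  simp only [flipD]
  apply Equiv.swap_apply_of_ne_of_ne <;> simp only [ne_eq, Fin.ext_iff, Fin.val_castSucc,
    Fin.val_last] <;> omega

theorem genD_comm {n : ℕ} (i : Fin n) (j : Fin (n + 1))
    (h : ((j : ℕ) < n ∧ ((i : ℕ) + 2 ≤ j ∨ (j : ℕ) + 2 ≤ i)) ∨ ((j : ℕ) = n ∧ (i : ℕ) + 2 ≠ n)) :
    gen (typeD n) i.castSucc * gen _ j = gen _ j * gen _ i.castSucc := by
  apply gen_comm
  have := i.2
  rw [typeD_apply, Fin.val_castSucc, if_neg (by omega), if_neg (by omega)]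

theorem genD_braid {n : ℕ} (i : Fin n) (j : Fin (n + 1))
    (h : ((j : ℕ) < n ∧ ((i : ℕ) + 1 = j ∨ (j : ℕ) + 1 = i)) ∨ ((j : ℕ) = n ∧ (i : ℕ) + 2 = n)) :
    gen (typeD n) i.castSucc * gen _ j * gen _ i.castSucc =
      gen _ j * gen _ i.castSucc * gen _ j := by
  apply gen_braid
  have := i.2
  rw [typeD_apply, Fin.val_castSucc, if_neg (by omega), if_pos (by omega)]

/-- The Artin-Tits group of type `B n` as fixed subgroup of the one of type `D (n + 1)`. -/
def embedD (n : ℕ) : ArtinGroup (CoxeterMatrix.B n) →* fixedArtin (groupD n) :=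
  liftFixed (deltaD n) (fun i => by
    have hi := i.2
    by_cases h : (i : ℕ) + 1 < n
    · simp only [deltaD, h, if_true]
      exact actArtin_flipD_of_lt i h
    · simp only [deltaD, h, if_false, map_mul, actArtin_gen]
      have h1 : i.castSucc = ⟨n - 1, by omega⟩ := Fin.ext (by simp only [Fin.val_castSucc]; omega)
      have h2 : (flipD n).1 i.castSucc = Fin.last n := by rw [h1]; exact Equiv.swap_apply_left _ _
      have h3 : (flipD n).1 (Fin.last n) = i.castSucc := by
        rw [h1]; exact Equiv.swap_apply_right _ _
      rw [h2, h3]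
      exact (genD_comm _ _ (Or.inr ⟨Fin.val_last n, by omega⟩)).symm) (by
    refine typeB_rel _ (fun i j h => ?_) (fun i j h h' => ?_) (fun i j h h' => ?_)
    · have hj := j.2
      by_cases h' : (j : ℕ) + 1 < n
      · simp only [deltaD, h', show (i : ℕ) + 1 < n by omega, if_true]
        exact genD_comm _ _ (by simp only [Fin.val_castSucc]; omega)
      · simp only [deltaD, h', show (i : ℕ) + 1 < n by omega, if_true, if_false]
        refine (Commute.mul_right ?_ ?_).eq
        · exact genD_comm _ _ (by simp only [Fin.val_castSucc]; omega)
        · exact genD_comm _ _ (Or.inr ⟨Fin.val_last n, by omega⟩)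
    · simp only [deltaD, h', show (i : ℕ) + 1 < n by omega, if_true]
      exact genD_braid _ _ (by simp only [Fin.val_castSucc]; omega)
    · simp only [deltaD, show ¬ (j : ℕ) + 1 < n by omega, show (i : ℕ) + 1 < n by omega,
        if_true, if_false]
      have := four_braid (x := gen (typeD n) j.castSucc)
        (y := gen _ i.castSucc) (z := gen _ (Fin.last n))
        (genD_braid _ _ (by simp only [Fin.val_castSucc]; omega))
        (genD_braid _ _ (Or.inr ⟨Fin.val_last n, by omega⟩)).symm
        (genD_comm _ _ (Or.inr ⟨Fin.val_last n, by omega⟩))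
      exact this.symm)

variable {R : Type*} [CommRing R] {P : Param R}

/-- The twisted LK-representation of the Artin-Tits group of type `B n` obtained from an
LK-representation of the Artin-Tits group of type `A (2 n - 1)`. -/
noncomputable def twistedAodd (n : ℕ) (F : LKFamilyGr (CoxeterMatrix.A (2 * n - 1)) P) :
    Representation R (ArtinGroup (CoxeterMatrix.B n)) (fixedModule R (groupA (2 * n - 1))) :=
  (twistedLKRep (isADE_typeA _) (groupA (2 * n - 1)) F).comp (embedAodd n)

/-- The twisted LK-representation of the Artin-Tits group of type `B n` obtained from an
LK-representation of the Artin-Tits group of type `A (2 n)`. -/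
noncomputable def twistedAeven (n : ℕ) (F : LKFamilyGr (CoxeterMatrix.A (2 * n)) P) :
    Representation R (ArtinGroup (CoxeterMatrix.B n)) (fixedModule R (groupA (2 * n))) :=
  (twistedLKRep (isADE_typeA _) (groupA (2 * n)) F).comp (embedAeven n)

/-- The twisted LK-representation of the Artin-Tits group of type `B n`, `n ≥ 3`, obtained from an
LK-representation of the Artin-Tits group of type `D (n + 1)`. -/
noncomputable def twistedD {n : ℕ} (hn : 3 ≤ n) (F : LKFamilyGr (typeD n) P) :
    Representation R (ArtinGroup (CoxeterMatrix.B n)) (fixedModule R (groupD n)) :=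
  (twistedLKRep (isADE_typeD hn) (groupD n) F).comp (embedD n)

end TypeB

/-- The ring `ℤ[x^{±1}, y^{±1}]`: the outer variable is `x`, the inner one is `y`. -/
abbrev LaurentXY : Type := LaurentPolynomial (LaurentPolynomial ℤ)

/-- The variable `y`, as a unit of `ℤ[x^{±1}, y^{±1}]`. -/
noncomputable def yUnit : LaurentXYˣ where
  val := LaurentPolynomial.C (LaurentPolynomial.T 1)
  inv := LaurentPolynomial.C (LaurentPolynomial.T (-1))
  val_inv := by rw [← map_mul, ← LaurentPolynomial.T_add]; simp
  inv_val := by rw [← map_mul, ← LaurentPolynomial.T_add]; simp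

/-- The parameters `(b, c, d) = (y ^ p, y ^ q, y ^ r)`. -/
noncomputable def yParam (p q r : ℤ) : Param LaurentXY := ⟨yUnit ^ p, yUnit ^ q, yUnit ^ r⟩

end LawrenceKrammer

/-! For the first statement, compare how the single generator `Δ_n` acts on the two modules, through
the endomorphism `X² - aX - bc`. In type `A_{2n-1}` the generator `Δ_n` acts as `ψ_i`, with `i` the
middle vertex. Modulo `e_{α_i}` the relation `φ_i² = aφ_i + bc` survives in `ψ_i`, so `X² - aX - bc`
maps the whole fixed module into the line `R e_{α_i}` (`twistedAodd_quadratic`). The property "the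
image lies in a submodule generated by one vector" is invariant under equivalence
(`exists_quadratic_of_equiv`).

In type `D_{n+1}`, `Δ_n` acts as `T = ψ_i ψ_j`, with `i`, `j` the ends of the fork. If a root `v` is
lowered by both reflections, the expansion of `(T² - aT - bc) e_v` contains `e_{v-α_j}` with
coefficient `ab²c` (`psi_mul_psi_quadratic`). Two such roots `v₁`, `v₂` fixed by the exchange give
two vectors whose coordinates along `v₁ - α_j` and `v₂ - α_j` form the matrix `ab²c · 1`. If both
vectors are multiples of one vector, its determinant vanishes, and since `b`, `c` are units, `a² =
0` (`twistedD_quadratic`). No assumption on the ring is needed up to there. In `ℤ[x^{±1}, y^{±1}]`,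
a domain, `a = 0` would give `d² = bc`, that is `y^{2r} = y^{p+q}`, which is excluded. Hence the
exceptional set can always be taken empty.

The second statement is a count of orbits. The fixed module is free on the orbits of the involution
on positive roots (`fixedModule_equiv_fun`). The positive roots are made explicit by the classical
coordinates: `ε_p - ε_q` with `p < q` in type `A` (`isRealized_typeA`), `ε_p ± ε_q` with `p < q` in
type `D` (`isRealized_typeD`). Counting orbits gives `n²`, `n(n+1)`, `n²`, and the ranks separate
the second representation from the two others. -/

namespace LawrenceKrammer

/-! ### Fixed vectors, and quadratic relations for `ψ_i` and for products `ψ_i ψ_j` -/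

section General

variable {I : Type*} [Fintype I] [DecidableEq I] {M : CoxeterMatrix I}
variable {R : Type*} [CommRing R] {P : Param R} {f : I → Module.Dual R (LKModule M R)}

theorem basisVec_apply {v : I → ℤ} (hv : IsPosRoot M v) (u : PosRoot M) :
    basisVec M R v u = if v = u.1 then 1 else 0 := by
  rw [basisVec_of_pos hv, Finsupp.single_apply]
  simp only [Subtype.ext_iff]

/-- The stabilizer of `x` is a subgroup, so it contains the powers of `g` as soon as it contains
`g`. -/
theorem mem_fixedModule_zpowers {g : coxeterAut M} {x : LKModule M R} :
    x ∈ fixedModule R (Subgroup.zpowers g) ↔ actModule R g x = x := by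
  refine ⟨fun h => h g (Subgroup.mem_zpowers g), fun h => ?_⟩
  have hm : ∀ k l : coxeterAut M, ∀ y : LKModule M R,
      actModule R (k * l) y = actModule R k (actModule R l y) := by
    intro k l y
    have : (actModule R (k * l)).toLinearMap =
        (actModule R k).toLinearMap ∘ₗ (actModule R l).toLinearMap := by
      refine lk_ext fun v hv => ?_
      simp only [LinearMap.comp_apply, LinearEquiv.coe_coe]
      rw [actModule_basis l hv, actModule_basis _ hv,
        actModule_basis k (isPosRoot_permLattice l hv)]
      rfl
    exact LinearMap.congr_fun this y
  have h1 : ∀ y : LKModule M R, actModule R (1 : coxeterAut M) y = y := by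
    intro y
    have : (actModule R (1 : coxeterAut M)).toLinearMap = LinearMap.id := by
      refine lk_ext fun v hv => ?_
      simp only [LinearMap.id_apply, LinearEquiv.coe_coe]
      rw [actModule_basis _ hv]
      rfl
    exact LinearMap.congr_fun this y
  let S : Subgroup (coxeterAut M) :=
    { carrier := {k | actModule R k x = x}
      one_mem' := h1 x
      mul_mem' := fun {k l} hk hl => by
        change actModule R (k * l) x = x
        rw [hm, hl, hk]
      inv_mem' := fun {k} hk => by
        change actModule R k⁻¹ x = x
        conv_lhs => rw [← (show actModule R k x = x from hk)]
        rw [← hm, inv_mul_cancel, h1] }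
  exact fun k hk => (Subgroup.zpowers_le.2 (show g ∈ S from h)) hk

theorem basisVec_mem_fixedModule {g : coxeterAut M} {v : I → ℤ} (hv : IsPosRoot M v)
    (h : permLattice g.1 v = v) : basisVec M R v ∈ fixedModule R (Subgroup.zpowers g) := by
  rw [mem_fixedModule_zpowers, actModule_basis g hv, h]

/-- `ψ_i` differs from `φ_i` by multiples of `e_{α_i}`, a vector killed by `φ_i`, and `phi_sq` is
the same relation for `φ_i` up to a multiple of `e_{α_i}`. -/
theorem psi_quadratic (hM : IsADE M) (i : I) (x : LKModule M R) :
    ∃ s : R, psi M P f i (psi M P f i x) = P.a • psi M P f i x + (P.b * P.c : R) • x +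
      s • basisVec M R (simpleRoot i) := by
  refine ⟨f i (phi M P i x) + f i x * f i (basisVec M R (simpleRoot i)) - P.a * f i x -
    P.b * P.c * coord R i x, ?_⟩
  simp only [psi_apply, map_add, map_smul, phi_simple, phi_sq hM]
  module

/-- The action of a product of two commuting generators on the basis vector of a root which is
decreased by both of them. -/
theorem psi_mul_psi_quadratic (hM : IsADE M) (hf : IsLKFamily M P f) {i j : I} (h : M i j = 2)
    {v : I → ℤ} (hv : IsPosRoot M v) (hi : form M v (simpleRoot i) = 1)
    (hj : form M v (simpleRoot j) = 1) :
    ∃ s t : R, (psi M P f i * psi M P f j) ((psi M P f i * psi M P f j) (basisVec M R v)) -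
        P.a • (psi M P f i * psi M P f j) (basisVec M R v) -
        (P.b * P.c : R) • basisVec M R v =
      (P.b * P.b * (P.a * P.a - P.a) : R) • basisVec M R (v - simpleRoot j - simpleRoot i) +
      (P.a * P.b * P.b * P.c : R) • basisVec M R (v - simpleRoot j) +
      (P.a * P.b * P.b * P.c : R) • basisVec M R (v - simpleRoot i) +
      (P.b * P.b * P.c * P.c - P.b * P.c : R) • basisVec M R v +
      s • basisVec M R (simpleRoot i) + t • basisVec M R (simpleRoot j) := by
  have h' : M j i = 2 := by rw [M.symmetric, h]
  have hij : i ≠ j := by rintro rfl; simp at h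
  have g1 : gram M i j = 0 := gram_two h
  have g2 : gram M j i = 0 := gram_two h'
  have pj := hM.sub_pos hv hj
  have pi := hM.sub_pos hv hi
  have hji : form M (v - simpleRoot j) (simpleRoot i) = 1 := by
    rw [form_sub_simple, g2, hi]; norm_num
  have pw := hM.sub_pos pj hji
  have wi : form M (v - simpleRoot j - simpleRoot i) (simpleRoot i) = -1 := by
    rw [form_sub_simple, gram_self, hji]; norm_num
  have wj : form M (v - simpleRoot j - simpleRoot i) (simpleRoot j) = -1 := by
    rw [form_sub_simple, form_sub_simple, gram_self, g1, hj]; norm_num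
  have hii : form M (v - simpleRoot i) (simpleRoot i) = -1 := by
    rw [form_sub_simple, gram_self, hi]; norm_num
  have e1 : v - simpleRoot j - simpleRoot i + simpleRoot j = v - simpleRoot i := by abel
  have ei := phi_zero (P := P) (R := R) (isPosRoot_simpleRoot i) (i := j)
    (by rw [form_simple, g1])
  have ej := phi_zero (P := P) (R := R) (isPosRoot_simpleRoot j) (i := i)
    (by rw [form_simple, g2])
  have q1 := phi_down (P := P) (R := R) hv hj
  have q2 := phi_down (P := P) (R := R) pj hji
  have q3 := phi_up (P := P) (R := R) pw wj
  have q4 := phi_up (P := P) (R := R) pw wi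
  have q5 := phi_up (P := P) (R := R) pi hii
  rw [e1] at q3
  rw [sub_add_cancel] at q4 q5
  -- Only `φ_i φ_j` matters modulo `e_{α_i}` and `e_{α_j}`. The exact coefficients are kept because
  -- the action on these two vectors is needed below.
  have F : ∀ x, (psi M P f i * psi M P f j) x = phi M P i (phi M P j x) +
      (f i (phi M P j x) + f j x * f i (basisVec M R (simpleRoot j))) •
        basisVec M R (simpleRoot i) + (f j x * P.d) • basisVec M R (simpleRoot j) := by
    intro x
    simp only [Module.End.mul_apply, psi_apply, map_add, map_smul, ej]
    module
  have F' : ∀ x, ∃ s t : R, (psi M P f i * psi M P f j) x = phi M P i (phi M P j x) +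
      s • basisVec M R (simpleRoot i) + t • basisVec M R (simpleRoot j) :=
    fun x => ⟨_, _, F x⟩
  obtain ⟨s1, t1, h1⟩ : ∃ s t : R, (psi M P f i * psi M P f j) (basisVec M R v) =
      (P.b * P.b : R) • basisVec M R (v - simpleRoot j - simpleRoot i) +
      s • basisVec M R (simpleRoot i) + t • basisVec M R (simpleRoot j) := by
    obtain ⟨s, t, h⟩ := F' (basisVec M R v)
    refine ⟨s, t, ?_⟩
    rw [h, q1, map_smul, q2, smul_smul]
  -- The root `v - α_j - α_i` is raised by both reflections, so `φ_i φ_j` spreads its basis vector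
  -- over the four roots between it and `v`. This is where `e_{v-α_j}` and `e_{v-α_i}` appear.
  obtain ⟨s2, t2, h2⟩ : ∃ s t : R, (psi M P f i * psi M P f j)
      (basisVec M R (v - simpleRoot j - simpleRoot i)) =
      (P.a * P.a : R) • basisVec M R (v - simpleRoot j - simpleRoot i) +
      (P.a * P.c : R) • basisVec M R (v - simpleRoot j) +
      (P.a * P.c : R) • basisVec M R (v - simpleRoot i) + (P.c * P.c : R) • basisVec M R v +
      s • basisVec M R (simpleRoot i) + t • basisVec M R (simpleRoot j) := by
    obtain ⟨s, t, h⟩ := F' (basisVec M R (v - simpleRoot j - simpleRoot i))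
    refine ⟨s, t, ?_⟩
    rw [h, q3, map_add, map_smul, map_smul, q4, q5]
    module
  -- `e_{α_i}` and `e_{α_j}` are eigenvectors of the product, so the error terms stay in their span
  -- when the product is applied a second time.
  have hi' : (psi M P f i * psi M P f j) (basisVec M R (simpleRoot i)) =
      (P.d * f i (basisVec M R (simpleRoot i))) • basisVec M R (simpleRoot i) := by
    rw [F, ei, map_smul, map_smul, phi_simple, hf.simple j i hij.symm, smul_eq_mul]
    module
  have hj' : (psi M P f i * psi M P f j) (basisVec M R (simpleRoot j)) =
      (P.d * f j (basisVec M R (simpleRoot j))) • basisVec M R (simpleRoot j) := by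
    rw [F, phi_simple, map_zero, map_zero, hf.simple i j hij]
    module
  refine ⟨P.b * P.b * s2 + s1 * (P.d * f i (basisVec M R (simpleRoot i))) - P.a * s1,
    P.b * P.b * t2 + t1 * (P.d * f j (basisVec M R (simpleRoot j))) - P.a * t1, ?_⟩
  rw [h1]
  simp only [map_add, map_smul, h2, hi', hj']
  module

/-- The coordinates of the vectors in `psi_mul_psi_quadratic` along a root `u` with
`u i = 1` and `u j = 0`, other than `α i`. -/
theorem psi_mul_psi_quadratic_apply (hM : IsADE M) (hf : IsLKFamily M P f) {i j l : I}
    (h : M i j = 2) (hil : i ≠ l) (hjl : j ≠ l) {v : I → ℤ} (hv : IsPosRoot M v)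
    (hi : form M v (simpleRoot i) = 1) (hj : form M v (simpleRoot j) = 1)
    (vi : v i = 1) (vj : v j = 1) (u : PosRoot M) (ui : u.1 i = 1) (uj : u.1 j = 0)
    (ul : u.1 l = 1) :
    ((psi M P f i * psi M P f j) ((psi M P f i * psi M P f j) (basisVec M R v)) -
        P.a • (psi M P f i * psi M P f j) (basisVec M R v) -
        (P.b * P.c : R) • basisVec M R v) u =
      if v - simpleRoot j = u.1 then P.a * P.b * P.b * P.c else 0 := by
  have hij : i ≠ j := by rintro rfl; simp at h
  obtain ⟨s, t, e⟩ := psi_mul_psi_quadratic hM hf h hv hi hj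
  have hji : form M (v - simpleRoot j) (simpleRoot i) = 1 := by
    rw [form_sub_simple, gram_two (by rw [M.symmetric, h]), hi]; norm_num
  have pj := hM.sub_pos hv hj
  -- The prescribed coordinates of `u` exclude every root of the expansion except `v - α_j`:
  -- coordinate `i` excludes those from which `α_i` was subtracted, coordinate `j` excludes `v`, and
  -- coordinate `l` excludes the two simple roots.
  have n1 : v - simpleRoot j - simpleRoot i ≠ u.1 := fun h => by
    simpa [ui, vi, simpleRoot, hij] using congrFun h i
  have n2 : v - simpleRoot i ≠ u.1 := fun h => by
    simpa [ui, vi, simpleRoot] using congrFun h i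
  have n3 : v ≠ u.1 := fun h => by simpa [uj, vj] using congrFun h j
  have n4 : simpleRoot i ≠ u.1 := fun h => by
    simpa [ul, simpleRoot, hil.symm] using congrFun h l
  have n5 : simpleRoot j ≠ u.1 := fun h => by
    simpa [ul, simpleRoot, hjl.symm] using congrFun h l
  rw [e]
  simp only [Finsupp.add_apply, Finsupp.smul_apply, basisVec_apply (hM.sub_pos pj hji),
    basisVec_apply pj, basisVec_apply (hM.sub_pos hv hi), basisVec_apply hv,
    basisVec_apply (isPosRoot_simpleRoot _), n1, n2, n3, n4, n5, if_false, smul_eq_mul, mul_zero,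
    add_zero, zero_add, mul_ite, mul_one]

end General

/-! ### The action of `Δ_n` on the two modules of rank `n²` -/

section TypeB

variable {R : Type*} [CommRing R] {P : Param R}

theorem liftFixed_gen {n : ℕ} {I : Type*} [Fintype I] [DecidableEq I] {M : CoxeterMatrix I}
    {g : coxeterAut M} (x : Fin n → ArtinGroup M) (hg : ∀ i, actArtin g (x i) = x i)
    (h : ∀ i j, altProd (x i) (x j) (CoxeterMatrix.B n i j) =
      altProd (x j) (x i) (CoxeterMatrix.B n i j)) (i : Fin n) :
    (liftFixed x hg h (gen _ i) : ArtinGroup M) = x i := by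
  rw [liftFixed, artinLift_gen]

theorem twistedAodd_last {n : ℕ} (hn : 0 < n) (F : LKFamilyGr (CoxeterMatrix.A (2 * n - 1)) P)
    (x : fixedModule R (groupA (2 * n - 1))) :
    (twistedAodd n F (gen _ ⟨n - 1, by omega⟩) x : LKModule (CoxeterMatrix.A (2 * n - 1)) R) =
      psi _ P F.f ⟨n - 1, by omega⟩ x := by
  change lkRep (isADE_typeA _) F (embedAodd n _ : ArtinGroup _) (x : LKModule _ R) = _
  have h : (embedAodd n (gen _ ⟨n - 1, by omega⟩) : ArtinGroup _) =
      deltaAodd n ⟨n - 1, by omega⟩ := liftFixed_gen _ _ _ _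
  rw [h, deltaAodd, if_neg (by simp only; omega), lkRep_gen]

theorem twistedD_last {n : ℕ} (hn : 3 ≤ n) (F : LKFamilyGr (typeD n) P)
    (x : fixedModule R (groupD n)) :
    (twistedD hn F (gen _ ⟨n - 1, by omega⟩) x : LKModule (typeD n) R) =
      (psi _ P F.f ⟨n - 1, by omega⟩ * psi _ P F.f (Fin.last n)) x := by
  change lkRep (isADE_typeD hn) F (embedD n _ : ArtinGroup _) (x : LKModule _ R) = _
  have h : (embedD n (gen _ ⟨n - 1, by omega⟩) : ArtinGroup _) =
      deltaD n ⟨n - 1, by omega⟩ := liftFixed_gen _ _ _ _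
  rw [h, deltaD, if_neg (by simp only; omega), map_mul, lkRep_gen, lkRep_gen]
  rfl

/-- The vector `e` is `e_α` for the simple root `α` of the middle vertex. It is a fixed vector
because the flip fixes this vertex, and `psi_quadratic` restricts to the fixed module. -/
theorem twistedAodd_quadratic {n : ℕ} (hn : 0 < n)
    (F : LKFamilyGr (CoxeterMatrix.A (2 * n - 1)) P) :
    ∃ e : fixedModule R (groupA (2 * n - 1)), ∀ x, ∃ s : R,
      twistedAodd n F (gen _ ⟨n - 1, by omega⟩) (twistedAodd n F (gen _ ⟨n - 1, by omega⟩) x) =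
        P.a • twistedAodd n F (gen _ ⟨n - 1, by omega⟩) x + (P.b * P.c : R) • x + s • e := by
  refine ⟨⟨basisVec _ R (simpleRoot ⟨n - 1, by omega⟩), basisVec_mem_fixedModule
    (isPosRoot_simpleRoot _) ?_⟩, fun x => ?_⟩
  · rw [permLattice_simple]
    congr 1
    ext
    simp only [flipA, Fin.revPerm_apply, Fin.val_rev]
    omega
  · obtain ⟨s, hs⟩ := psi_quadratic (P := P) (f := F.f) (isADE_typeA _)
      (⟨n - 1, by omega⟩ : Fin (2 * n - 1)) (x : LKModule (CoxeterMatrix.A (2 * n - 1)) R)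
    refine ⟨s, Subtype.ext ?_⟩
    simp only [Submodule.coe_add, Submodule.coe_smul, twistedAodd_last hn]
    exact hs

theorem permLattice_add {I : Type*} (g : Equiv.Perm I) (v w : I → ℤ) :
    permLattice g (v + w) = permLattice g v + permLattice g w := rfl

/-- A 2×2 minor obstructs the quadratic relation modulo a single vector: two fixed basis vectors are
mapped by `X² - aX - bc` to vectors with a minor equal to `(ab²c)²`. Over an arbitrary ring this
yields `a² = 0`, not `a = 0`. -/
theorem twistedD_quadratic {n : ℕ} (hn : 3 ≤ n) (F : LKFamilyGr (typeD n) P)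
    (e : fixedModule R (groupD n))
    (he : ∀ x, ∃ s : R,
      twistedD hn F (gen _ ⟨n - 1, by omega⟩) (twistedD hn F (gen _ ⟨n - 1, by omega⟩) x) =
        P.a • twistedD hn F (gen _ ⟨n - 1, by omega⟩) x + (P.b * P.c : R) • x + s • e) :
    P.a * P.a = 0 := by
  have hM := isADE_typeD hn
  -- `i` and `j` are the ends of the fork, `l` is the branch vertex, and `k` is its third neighbour,
  -- which exists because `n ≥ 3`.
  set i : Fin (n + 1) := ⟨n - 1, by omega⟩ with hi
  set j : Fin (n + 1) := Fin.last n with hj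
  set l : Fin (n + 1) := ⟨n - 2, by omega⟩ with hl
  set k : Fin (n + 1) := ⟨n - 3, by omega⟩ with hk
  have hij : i ≠ j := by simp only [hi, hj, ne_eq, Fin.ext_iff, Fin.val_last]; omega
  have hil : i ≠ l := by simp only [hi, hl, ne_eq, Fin.ext_iff]; omega
  have hik : i ≠ k := by simp only [hi, hk, ne_eq, Fin.ext_iff]; omega
  have hjl : j ≠ l := by simp only [hj, hl, ne_eq, Fin.ext_iff, Fin.val_last]; omega
  have hjk : j ≠ k := by simp only [hj, hk, ne_eq, Fin.ext_iff, Fin.val_last]; omega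
  have hlk : l ≠ k := by simp only [hl, hk, ne_eq, Fin.ext_iff]; omega
  have vi : (i : ℕ) = n - 1 := rfl
  have vj : (j : ℕ) = n := rfl
  have vl : (l : ℕ) = n - 2 := rfl
  have vk : (k : ℕ) = n - 3 := rfl
  have mij : typeD n i j = 2 := by
    rw [typeD_apply, if_neg (by omega), if_neg (by omega)]
  have mli : typeD n l i = 3 := by
    rw [typeD_apply, if_neg (by omega), if_pos (by omega)]
  have mlj : typeD n l j = 3 := by
    rw [typeD_apply, if_neg (by omega), if_pos (by omega)]
  have mlk : typeD n l k = 3 := by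
    rw [typeD_apply, if_neg (by omega), if_pos (by omega)]
  have mik : typeD n i k = 2 := by
    rw [typeD_apply, if_neg (by omega), if_neg (by omega)]
  have mjk : typeD n j k = 2 := by
    rw [typeD_apply, if_neg (by omega), if_neg (by omega)]
  have gij := gram_two mij
  have gji : gram (typeD n) j i = 0 := by rw [gram_symm, gij]
  have gli := gram_three mli
  have glj := gram_three mlj
  have glk := gram_three mlk
  have gik := gram_two mik
  have gjk := gram_two mjk
  have gki : gram (typeD n) k i = 0 := by rw [gram_symm, gik]
  have gkj : gram (typeD n) k j = 0 := by rw [gram_symm, gjk]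
  have p1 := hM.add_pos (isPosRoot_simpleRoot l) (i := i) (by rw [form_simple, gli])
  have p2 := hM.add_pos p1 (i := j) (by
    rw [form_add_simple, form_simple, glj, gij]; norm_num)
  have p3 := hM.add_pos p2 (i := k) (by
    rw [form_add_simple, form_add_simple, form_simple, glk, gik, gjk]; norm_num)
  -- Both roots contain `α_i` and `α_j` symmetrically, so they are fixed by the exchange, and both
  -- are lowered by each of the two reflections.
  set v₁ := simpleRoot l + simpleRoot i + simpleRoot j with hv₁
  set v₂ := v₁ + simpleRoot k with hv₂
  have f1i : form (typeD n) v₁ (simpleRoot i) = 1 := by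
    rw [form_add_simple, form_add_simple, form_simple, gli, gram_self, gji]; norm_num
  have f1j : form (typeD n) v₁ (simpleRoot j) = 1 := by
    rw [form_add_simple, form_add_simple, form_simple, glj, gram_self, gij]; norm_num
  have f2i : form (typeD n) v₂ (simpleRoot i) = 1 := by
    rw [form_add_simple, f1i, gki]; norm_num
  have f2j : form (typeD n) v₂ (simpleRoot j) = 1 := by
    rw [form_add_simple, f1j, gkj]; norm_num
  have hgi : (flipD n).1 i = j := Equiv.swap_apply_left _ _
  have hgj : (flipD n).1 j = i := Equiv.swap_apply_right _ _
  have hgl : (flipD n).1 l = l := Equiv.swap_apply_of_ne_of_ne hil.symm hjl.symm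
  have hgk : (flipD n).1 k = k := Equiv.swap_apply_of_ne_of_ne hik.symm hjk.symm
  have s1 : permLattice (flipD n).1 v₁ = v₁ := by
    rw [hv₁, permLattice_add, permLattice_add, permLattice_simple, permLattice_simple,
      permLattice_simple, hgi, hgj, hgl, add_right_comm]
  have s2 : permLattice (flipD n).1 v₂ = v₂ := by
    rw [hv₂, permLattice_add, s1, permLattice_simple, hgk]
  -- These roots are not fixed by the exchange. They only serve to read off coordinates in the whole
  -- module.
  let u₁ : PosRoot (typeD n) := ⟨v₁ - simpleRoot j, hM.sub_pos p2 f1j⟩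
  let u₂ : PosRoot (typeD n) := ⟨v₂ - simpleRoot j, hM.sub_pos p3 f2j⟩
  have ne : v₂ ≠ v₁ := by simp [hv₂, simpleRoot_ne_zero]
  have key : ∀ (v : Fin (n + 1) → ℤ) (hv : IsPosRoot (typeD n) v)
      (_ : permLattice (flipD n).1 v = v) (_ : form (typeD n) v (simpleRoot i) = 1)
      (_ : form (typeD n) v (simpleRoot j) = 1) (_ : v i = 1) (_ : v j = 1),
      ∃ s : R, ∀ u : PosRoot (typeD n), u.1 i = 1 → u.1 j = 0 → u.1 l = 1 →
        s * (e : LKModule (typeD n) R) u =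
          if v - simpleRoot j = u.1 then P.a * P.b * P.b * P.c else 0 := by
    intro v hv hs hvi hvj vi vj
    obtain ⟨s, hs⟩ := he ⟨basisVec _ R v, basisVec_mem_fixedModule hv hs⟩
    refine ⟨s, fun u ui uj ul => ?_⟩
    rw [← psi_mul_psi_quadratic_apply hM F.isLKFamily mij hil hjl hv hvi hvj vi vj u ui uj ul]
    have := congrArg (fun y : fixedModule R (groupD n) => (y : LKModule (typeD n) R) u) hs
    simp only [Submodule.coe_add, Submodule.coe_smul, twistedD_last hn, Finsupp.add_apply] at this
    rw [Finsupp.sub_apply, Finsupp.sub_apply, sub_sub]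
    exact eq_sub_of_add_eq' this.symm
  obtain ⟨s, hs⟩ := key v₁ p2 s1 f1i f1j (by simp [v₁, simpleRoot, hij, hil])
    (by simp [v₁, simpleRoot, hij.symm, hjl])
  obtain ⟨t, ht⟩ := key v₂ p3 s2 f2i f2j (by simp [v₂, v₁, simpleRoot, hij, hil, hik])
    (by simp [v₂, v₁, simpleRoot, hij.symm, hjl, hjk])
  have u1 : u₁.1 i = 1 ∧ u₁.1 j = 0 ∧ u₁.1 l = 1 := by
    simp [u₁, v₁, simpleRoot, hij, hil, hjl, hij.symm, hil.symm, hjl.symm]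
  have u2 : u₂.1 i = 1 ∧ u₂.1 j = 0 ∧ u₂.1 l = 1 := by
    simp [u₂, v₂, v₁, simpleRoot, hij, hil, hjl, hij.symm, hil.symm, hjl.symm, hik, hjk, hlk]
  -- Three entries of the 2×2 matrix suffice: its diagonal entries are `ab²c`, and one vanishing
  -- off-diagonal entry already determines the determinant.
  have a11 := hs u₁ u1.1 u1.2.1 u1.2.2
  have a12 := hs u₂ u2.1 u2.2.1 u2.2.2
  have a22 := ht u₂ u2.1 u2.2.1 u2.2.2
  rw [if_pos rfl] at a11 a22
  rw [if_neg (by simpa [u₂, sub_left_inj] using ne.symm)] at a12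
  -- Proportionality gives `(s e(u₁)) (t e(u₂)) = (t e(u₁)) (s e(u₂))`, where the left side is
  -- `(ab²c)²` and the right side is `0`.
  have h0 : ((P.b * P.b * P.c * (P.b * P.b * P.c) : Rˣ) : R) * (P.a * P.a) = 0 := by
    push_cast
    linear_combination (-s * e.1 u₁) * a22 - (P.a * P.b * P.b * P.c) * a11 +
      t * e.1 u₁ * a12
  exact (Units.mul_right_eq_zero _).1 h0

/-- An intertwining isomorphism carries the relation over term by term, with `e` replaced by its
image and the same scalars `s`. -/
theorem exists_quadratic_of_equiv {G V W : Type*} [Group G] [AddCommMonoid V] [Module R V]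
    [AddCommMonoid W] [Module R W] {ρ : Representation R G V} {σ : Representation R G W}
    (E : ρ.Equiv σ) (g : G) (a b : R)
    (h : ∃ e : V, ∀ x, ∃ s : R, ρ g (ρ g x) = a • ρ g x + b • x + s • e) :
    ∃ e : W, ∀ x, ∃ s : R, σ g (σ g x) = a • σ g x + b • x + s • e := by
  obtain ⟨e, he⟩ := h
  refine ⟨E.toLinearEquiv e, fun y => ?_⟩
  obtain ⟨x, rfl⟩ := E.toLinearEquiv.surjective y
  obtain ⟨s, hs⟩ := he x
  have hE : ∀ z, σ g (E.toLinearEquiv z) = E.toLinearEquiv (ρ g z) := fun z =>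
    (LinearMap.congr_fun (E.toIntertwiningMap.isIntertwining' g) z).symm
  refine ⟨s, ?_⟩
  simpa only [hE, map_add, map_smul] using congrArg E.toLinearEquiv hs

/-- The two twisted representations of rank `n ^ 2` are not equivalent as soon as `a ^ 2 ≠ 0`. -/
theorem not_equiv_twistedAodd_twistedD {n : ℕ} (hn : 3 ≤ n) (ha : P.a * P.a ≠ 0)
    (F₁ : LKFamilyGr (CoxeterMatrix.A (2 * n - 1)) P) (F₃ : LKFamilyGr (typeD n) P) :
    ¬ Nonempty ((twistedAodd n F₁).Equiv (twistedD hn F₃)) := by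
  rintro ⟨E⟩
  obtain ⟨e, he⟩ := exists_quadratic_of_equiv E (gen (CoxeterMatrix.B n) ⟨n - 1, by omega⟩) _ _
    (twistedAodd_quadratic (by omega) F₁)
  exact ha (twistedD_quadratic hn F₃ e he)

end TypeB

/-! ### The parameter `a` in the Laurent polynomial ring -/

theorem yUnit_zpow (k : ℤ) :
    ((yUnit ^ k : LaurentXYˣ) : LaurentXY) = LaurentPolynomial.C (LaurentPolynomial.T k) := by
  have h : ∀ k : ℕ, ((yUnit ^ k : LaurentXYˣ) : LaurentXY) =
      LaurentPolynomial.C (LaurentPolynomial.T k) := fun k => by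
    rw [Units.val_pow_eq_pow_val, yUnit, ← map_pow, LaurentPolynomial.T_pow, mul_one]
  obtain ⟨k, rfl | rfl⟩ := k.eq_nat_or_neg
  · rw [zpow_natCast, h]
  · rw [zpow_neg, zpow_natCast, Units.inv_eq_of_mul_eq_one_right]
    rw [h, ← map_mul, ← LaurentPolynomial.T_add]
    simp

theorem yUnit_zpow_injective : Function.Injective fun k : ℤ => yUnit ^ k := by
  intro k l h
  have := congrArg (fun u : LaurentXYˣ => (u : LaurentXY)) h
  simp only [yUnit_zpow] at this
  -- The coefficient of `x⁰ y^k` is `1` in `y^k`, and in `y^l` it is `1` only for `l = k`.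
  have h2 := congrArg (fun z : LaurentXY => (z.coeff 0).coeff k) this
  exact (by simpa [LaurentPolynomial.C_apply] using h2 : l = k).symm

/-- The relation `d² = ad + bc` turns `a = 0` into `y^{2r} = y^{p+q}`. -/
theorem yParam_a_ne_zero {p q r : ℤ} (h : 2 * r ≠ p + q) : (yParam p q r).a ≠ 0 := by
  intro h0
  have h1 : yUnit ^ (r + r) = yUnit ^ (p + q) := by
    ext1
    have := (yParam p q r).rel
    rw [h0, zero_mul, zero_add] at this
    rw [zpow_add, zpow_add, Units.val_mul, Units.val_mul]
    exact this
  have := yUnit_zpow_injective h1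
  omega


/-! ### Fixed modules and orbits of positive roots -/

section Orbits

variable {I : Type*} [Fintype I] [DecidableEq I] {M : CoxeterMatrix I}

/-- The fixed submodule of an involution `g` is free on a set `T` of representatives of the orbits
of `g` on the positive roots. -/
theorem fixedModule_equiv_fun (R : Type*) [CommRing R] {T : Type*} [Finite T] {g : coxeterAut M}
    (hg : g * g = 1) (r : T → PosRoot M) (hr : Function.Injective r)
    (cover : ∀ v, ∃ t, v = r t ∨ v = permRoot g (r t))
    (hd : ∀ t t', permRoot g (r t) = r t' → t = t') :
    Nonempty (fixedModule R (Subgroup.zpowers g) ≃ₗ[R] (T → R)) := by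
  have hgg : ∀ v : PosRoot M, permRoot g (permRoot g v) = v := by
    intro v
    refine Subtype.ext ?_
    change permLattice (g * g).1 v.1 = v.1
    rw [hg]; rfl
  have hsymm : ∀ v : PosRoot M, (permRoot g).symm v = permRoot g v := fun v => by
    rw [Equiv.symm_apply_eq, hgg]
  -- Each orbit has at most two elements, so the finiteness of the root system follows from that of
  -- `T`. It is what allows an arbitrary function on the roots to be a vector of the module below.
  have hfin : Finite (PosRoot M) := by
    refine Finite.of_surjective
      (fun z : T × Bool => if z.2 then r z.1 else permRoot g (r z.1)) fun v => ?_
    obtain ⟨t, h | h⟩ := cover v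
    · exact ⟨(t, true), by simp [h]⟩
    · exact ⟨(t, false), by simp [h]⟩
  have hact : ∀ x : LKModule M R, ∀ v, actModule R g x v = x (permRoot g v) := fun x v => by
    rw [← hsymm]; rfl
  -- `τ` sends a root to the index of its orbit. It is a retraction of `r` and is constant on
  -- orbits.
  choose τ hτ using cover
  have τr : ∀ t, τ (r t) = t := fun t => by
    rcases hτ (r t) with h | h
    · exact (hr h).symm
    · exact hd _ _ h.symm
  have τg : ∀ v, τ (permRoot g v) = τ v := fun v => by
    have aux : ∀ t, τ (permRoot g (r t)) = t := fun t => by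
      rcases hτ (permRoot g (r t)) with h | h
      · exact (hd _ _ h).symm
      · exact (hr ((permRoot g).injective h)).symm
    rcases hτ v with h | h
    · conv_lhs => rw [h, aux]
    · conv_lhs => rw [h, hgg, τr]
  -- A fixed vector is a function on the roots that is constant on orbits, hence determined by its
  -- values at the representatives. Conversely `h ∘ τ` extends a function `h` on representatives.
  -- Orbits of size one and two need no distinction.
  let L : fixedModule R (Subgroup.zpowers g) →ₗ[R] (T → R) :=
    LinearMap.pi fun t => Finsupp.lapply (r t) ∘ₗ Submodule.subtype _
  have hL : ∀ x t, L x t = x.1 (r t) := fun _ _ => rfl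
  refine ⟨LinearEquiv.ofBijective L ⟨?_, ?_⟩⟩
  · intro x y hxy
    refine Subtype.ext (Finsupp.ext fun v => ?_)
    have h0 : ∀ t, x.1 (r t) = y.1 (r t) := fun t => by rw [← hL, hxy, hL]
    rcases hτ v with h | h
    · rw [h, h0]
    · rw [h, ← hact, ← hact, mem_fixedModule_zpowers.1 x.2, mem_fixedModule_zpowers.1 y.2, h0]
  · intro h
    refine ⟨⟨Finsupp.equivFunOnFinite.symm (h ∘ τ), mem_fixedModule_zpowers.2 ?_⟩, ?_⟩
    · ext v
      rw [hact]
      simp [τg]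
    · ext t
      rw [hL]
      simp [τr]

end Orbits

/-! ### Realizing positive roots as integral vectors -/

section Realization

theorem linearCombination_simpleRoot {I N : Type*} [Fintype I] [DecidableEq I] (a : I → N → ℤ)
    (i : I) : Fintype.linearCombination ℤ a (simpleRoot i) = a i := by
  simp [simpleRoot]

theorem linearCombination_permLattice {I N : Type*} [Fintype I] {a : I → N → ℤ}
    {g : Equiv.Perm I} {τ : (N → ℤ) →ₗ[ℤ] (N → ℤ)}
    (hτ : ∀ i, τ (a i) = a (g i)) (v : I → ℤ) :
    Fintype.linearCombination ℤ a (permLattice g v) = τ (Fintype.linearCombination ℤ a v) := by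
  simp only [Fintype.linearCombination_apply, map_sum, map_smul, hτ]
  rw [← Equiv.sum_comp g]
  simp [permLattice]

variable {I N : Type*} [Fintype I] [DecidableEq I] [Fintype N] {M : CoxeterMatrix I}
  {a u : I → N → ℤ}

/-- Pairing with `u j` reads off a coordinate, which gives both the injectivity of the realization
and a test of positivity. The dual vectors are doubled so that the spin weights of type `D` become
integral. -/
theorem linearCombination_dotProduct (h2 : ∀ i j, a i ⬝ᵥ u j = if i = j then 2 else 0)
    (v : I → ℤ) (j : I) : Fintype.linearCombination ℤ a v ⬝ᵥ u j = 2 * v j := by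
  simp only [Fintype.linearCombination_apply, sum_dotProduct, smul_dotProduct, h2, smul_eq_mul,
    mul_ite, mul_zero, Finset.sum_ite_eq', Finset.mem_univ, if_true]
  ring

theorem linearCombination_injective (h2 : ∀ i j, a i ⬝ᵥ u j = if i = j then 2 else 0) :
    Function.Injective (Fintype.linearCombination ℤ a) := by
  intro v w h
  ext j
  have h1 := linearCombination_dotProduct h2 v j
  rw [h, linearCombination_dotProduct h2] at h1
  omega

theorem form_eq_dotProduct (h1 : ∀ i j, a i ⬝ᵥ a j = gram M i j) (v w : I → ℤ) :
    form M v w = Fintype.linearCombination ℤ a v ⬝ᵥ Fintype.linearCombination ℤ a w := by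
  simp only [form, Matrix.toBilin'_apply, Fintype.linearCombination_apply, sum_dotProduct,
    dotProduct_sum, smul_dotProduct, dotProduct_smul, h1, smul_eq_mul]
  rw [Finset.sum_comm]
  refine Finset.sum_congr rfl fun i _ => ?_
  rw [Finset.mul_sum]
  exact Finset.sum_congr rfl fun j _ => mul_comm _ _

/-- The vectors that realize positive roots. -/
def IsRealized {I N : Type*} [Fintype I] [DecidableEq I] (M : CoxeterMatrix I) (a : I → N → ℤ)
    (x : N → ℤ) : Prop :=
  ∃ v, IsPosRoot M v ∧ Fintype.linearCombination ℤ a v = x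

omit [Fintype N] in
theorem isRealized_simple (i : I) : IsRealized M a (a i) :=
  ⟨_, isPosRoot_simpleRoot i, linearCombination_simpleRoot a i⟩

theorem IsRealized.dotProduct_self (h1 : ∀ i j, a i ⬝ᵥ a j = gram M i j) {x : N → ℤ}
    (hx : IsRealized M a x) : x ⬝ᵥ x = 2 := by
  obtain ⟨v, hv, rfl⟩ := hx
  rw [← form_eq_dotProduct h1, hv.1.norm]

theorem IsRealized.dotProduct_nonneg (h2 : ∀ i j, a i ⬝ᵥ u j = if i = j then 2 else 0)
    {x : N → ℤ} (hx : IsRealized M a x) (j : I) : 0 ≤ x ⬝ᵥ u j := by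
  obtain ⟨v, hv, rfl⟩ := hx
  rw [linearCombination_dotProduct h2]
  exact mul_nonneg zero_le_two (hv.2 j)

/-- The sum is the reflection of `x` in `a i`. This is the step that builds all positive roots from
simple ones in the explicit models. -/
theorem IsRealized.add (hM : IsADE M) (h1 : ∀ i j, a i ⬝ᵥ a j = gram M i j) {x : N → ℤ}
    (hx : IsRealized M a x) (i : I) (h : x ⬝ᵥ a i = -1) : IsRealized M a (x + a i) := by
  obtain ⟨v, hv, rfl⟩ := hx
  refine ⟨v + simpleRoot i, hM.add_pos hv ?_, ?_⟩
  · rw [form_eq_dotProduct h1, linearCombination_simpleRoot, h]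
  · rw [map_add, linearCombination_simpleRoot]

omit [Fintype N] in
theorem IsRealized.map {g : coxeterAut M} {τ : (N → ℤ) →ₗ[ℤ] (N → ℤ)}
    (hτ : ∀ i, τ (a i) = a (g.1 i)) {x : N → ℤ} (hx : IsRealized M a x) :
    IsRealized M a (τ x) := by
  obtain ⟨v, hv, rfl⟩ := hx
  exact ⟨_, isPosRoot_permLattice g hv, linearCombination_permLattice hτ v⟩

/-- The realization is injective and turns the graph automorphism into `τ`, so representatives of
orbits can be chosen among explicit vectors instead of coordinates along simple roots. -/
theorem fixedModule_equiv_of_realization (R : Type*) [CommRing R]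
    (h2 : ∀ i j, a i ⬝ᵥ u j = if i = j then 2 else 0) {g : coxeterAut M} (hg : g * g = 1)
    (τ : (N → ℤ) →ₗ[ℤ] (N → ℤ)) (hτ : ∀ i, τ (a i) = a (g.1 i)) {T : Type*} [Finite T]
    (x : T → N → ℤ) (hx : Function.Injective x) (hr : ∀ t, IsRealized M a (x t))
    (cover : ∀ y, IsRealized M a y → ∃ t, y = x t ∨ y = τ (x t))
    (hd : ∀ t t', τ (x t) = x t' → t = t') :
    Nonempty (fixedModule R (Subgroup.zpowers g) ≃ₗ[R] (T → R)) := by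
  choose v hv hvx using hr
  have E : ∀ w w' : PosRoot M, w = w' ↔
      Fintype.linearCombination ℤ a w.1 = Fintype.linearCombination ℤ a w'.1 := fun w w' => by
    rw [(linearCombination_injective h2).eq_iff, Subtype.ext_iff]
  have Eg : ∀ w : PosRoot M, Fintype.linearCombination ℤ a (permRoot g w).1 =
      τ (Fintype.linearCombination ℤ a w.1) := fun w => linearCombination_permLattice hτ w.1
  refine fixedModule_equiv_fun R hg (fun t => ⟨v t, hv t⟩) (fun t t' h => ?_) (fun w => ?_)
    fun t t' h => ?_
  · rw [E] at h
    exact hx (by simpa only [hvx] using h)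
  · simp only [E, Eg, hvx]
    exact cover _ ⟨w.1, w.2, rfl⟩
  · rw [E, Eg] at h
    exact hd _ _ (by simpa only [hvx] using h)

end Realization

/-! ### Integral vectors with two nonzero coordinates -/

section Pairs

variable {m : ℕ}

/-- The vector `ε p + t ε q`. -/
def pairVec (p q : Fin m) (t : ℤ) : Fin m → ℤ := Pi.single p 1 + Pi.single q t

theorem pairVec_apply (p q : Fin m) (t : ℤ) (k : Fin m) :
    pairVec p q t k = (if (k : ℕ) = p then 1 else 0) + if (k : ℕ) = q then t else 0 := by
  simp [pairVec, Pi.single_apply, Fin.ext_iff]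

theorem pairVec_dotProduct (p q : Fin m) (t : ℤ) (w : Fin m → ℤ) :
    pairVec p q t ⬝ᵥ w = w p + t * w q := by
  simp [pairVec, add_dotProduct, single_dotProduct]

/-- The support `{p, q}` determines the pair because it is ordered, and `t` is then the coefficient
at `q`. -/
theorem pairVec_inj {p q p' q' : Fin m} {t t' : ℤ} (h : p < q) (h' : p' < q') (ht : t ≠ 0)
    (ht' : t' ≠ 0) (e : pairVec p q t = pairVec p' q' t') : p = p' ∧ q = q' ∧ t = t' := by
  rw [Fin.lt_def] at h h'
  simp only [Fin.ext_iff]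
  have e1 := congrFun e p
  have e2 := congrFun e q
  have e3 := congrFun e p'
  rw [pairVec_apply, pairVec_apply, if_pos rfl, if_neg (by omega)] at e1
  rw [pairVec_apply, pairVec_apply, if_neg (by omega), if_pos rfl] at e2
  rw [pairVec_apply, pairVec_apply p', if_pos (c := (p' : ℕ) = p') rfl,
    if_neg (c := (p' : ℕ) = q') (by omega)] at e3
  have hp : (p : ℕ) = p' := by
    rcases lt_trichotomy (p : ℕ) p' with hp | hp | hp
    · rw [if_neg (by omega), if_neg (by omega)] at e1
      omega
    · exact hp
    · rw [if_neg (by omega), if_neg (by omega)] at e3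
      omega
  rw [if_neg (by omega)] at e2
  split_ifs at e2 <;> omega

/-- The integral vectors of norm `2`. -/
theorem exists_pair_of_dotProduct_self {x : Fin m → ℤ} (h : x ⬝ᵥ x = 2) :
    ∃ p q, p < q ∧ ∃ s t : ℤ, (s = 1 ∨ s = -1) ∧ (t = 1 ∨ t = -1) ∧
      x = Pi.single p s + Pi.single q t := by
  have h0 : ∀ S : Finset (Fin m), ∑ k ∈ S, x k * x k ≠ 0 → ∃ p ∈ S, x p ≠ 0 := fun S hS => by
    obtain ⟨p, hp, h⟩ := Finset.exists_ne_zero_of_sum_ne_zero hS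
    exact ⟨p, hp, fun h' => h (by rw [h', zero_mul])⟩
  have h1 : ∀ y : ℤ, y ≠ 0 → y * y ≤ 2 → y = 1 ∨ y = -1 := fun y hy h => by
    have : y < 2 := by nlinarith
    have : -2 < y := by nlinarith
    omega
  have hn : ∀ S : Finset (Fin m), 0 ≤ ∑ k ∈ S, x k * x k := fun S =>
    Finset.sum_nonneg fun k _ => mul_self_nonneg _
  rw [dotProduct] at h
  obtain ⟨p, hp, hxp⟩ := h0 Finset.univ (by rw [h]; norm_num)
  have sp := Finset.add_sum_erase Finset.univ (fun k => x k * x k) hp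
  have np := hn (Finset.univ.erase p)
  have vp := h1 _ hxp (by linarith)
  have wp : x p * x p = 1 := by rcases vp with h | h <;> rw [h] <;> norm_num
  -- The coordinate at `p` is `±1`, so the remaining squares sum to `1`. A second nonzero coordinate
  -- therefore exists and exhausts the sum.
  obtain ⟨q, hq, hxq⟩ := h0 (Finset.univ.erase p) (by linarith)
  have sq := Finset.add_sum_erase (Finset.univ.erase p) (fun k => x k * x k) hq
  have nq := hn ((Finset.univ.erase p).erase q)
  have vq := h1 _ hxq (by linarith)
  have wq : x q * x q = 1 := by rcases vq with h | h <;> rw [h] <;> norm_num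
  have hpq : q ≠ p := Finset.ne_of_mem_erase hq
  have hz : ∀ k, k ≠ p → k ≠ q → x k = 0 := fun k kp kq => by
    have := (Finset.sum_eq_zero_iff_of_nonneg fun k _ => mul_self_nonneg (x k)).1
      (by linarith : ∑ k ∈ (Finset.univ.erase p).erase q, x k * x k = 0) k (by simp [kp, kq])
    exact mul_self_eq_zero.1 this
  have hx : x = Pi.single p (x p) + Pi.single q (x q) := by
    ext k
    by_cases kp : k = p
    · subst kp; simp [hpq.symm]
    by_cases kq : k = q
    · subst kq; simp [kp]
    simp [kp, kq, hz k kp kq]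
  rcases lt_or_gt_of_ne hpq with h | h
  · exact ⟨q, p, h, _, _, vq, vp, by rw [add_comm]; exact hx⟩
  · exact ⟨p, q, h, _, _, vp, vq, hx⟩

end Pairs

/-! ### Type `A`: positive roots `ε_p - ε_q` and their orbits -/

section TypeA

/-- The simple roots of type `A m` in `ℤ ^ (m + 1)`. -/
def rootsA (m : ℕ) (i : Fin m) : Fin (m + 1) → ℤ := pairVec i.castSucc i.succ (-1)

/-- Twice the fundamental weights of type `A m`, up to multiples of `(1, …, 1)`. -/
def weightsA (m : ℕ) (i : Fin m) (k : Fin (m + 1)) : ℤ := if (k : ℕ) ≤ i then 2 else 0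

theorem rootsA_dotProduct {m : ℕ} (i j : Fin m) :
    rootsA m i ⬝ᵥ rootsA m j = gram (CoxeterMatrix.A m) i j := by
  simp only [rootsA, pairVec_dotProduct, pairVec_apply, gram, Matrix.of_apply, typeA_apply,
    Fin.ext_iff, Fin.val_castSucc, Fin.val_succ]
  split_ifs <;> omega

theorem rootsA_dotProduct_weightsA {m : ℕ} (i j : Fin m) :
    rootsA m i ⬝ᵥ weightsA m j = if i = j then 2 else 0 := by
  simp only [rootsA, pairVec_dotProduct, weightsA, Fin.ext_iff, Fin.val_castSucc, Fin.val_succ]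
  split_ifs <;> omega

/-- A positive root has norm `2`, so it is `±ε_p ± ε_q`; its signs are fixed by orthogonality to
`(1, …, 1)` and by positivity. Conversely `ε_p - ε_q` is reached from a simple root by raising `q`
one step at a time. -/
theorem isRealized_typeA {m : ℕ} {x : Fin (m + 1) → ℤ} :
    IsRealized (CoxeterMatrix.A m) (rootsA m) x ↔ ∃ p q, p < q ∧ x = pairVec p q (-1) := by
  constructor
  · intro hx
    obtain ⟨p, q, hpq, s, t, hs, ht, rfl⟩ :=
      exists_pair_of_dotProduct_self (hx.dotProduct_self rootsA_dotProduct)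
    rw [Fin.lt_def] at hpq
    have hq := q.2
    -- This weight sees `p` but not `q > p`, so it gives `0 ≤ s`.
    have h1 := hx.dotProduct_nonneg rootsA_dotProduct_weightsA ⟨p, by omega⟩
    simp only [add_dotProduct, single_dotProduct, weightsA] at h1
    rw [if_pos le_rfl, if_neg (by omega)] at h1
    -- All simple roots, hence all roots, have coordinate sum zero.
    have h2 : s + t = 0 := by
      obtain ⟨v, -, hv⟩ := hx
      have h3 : Fintype.linearCombination ℤ (rootsA m) v ⬝ᵥ 1 = 0 := by
        rw [Fintype.linearCombination_apply, sum_dotProduct]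
        refine Finset.sum_eq_zero fun i _ => ?_
        rw [smul_dotProduct, rootsA, pairVec_dotProduct]
        simp
      rw [hv] at h3
      simpa [add_dotProduct, single_dotProduct] using h3
    refine ⟨p, q, hpq, ?_⟩
    obtain rfl : s = 1 := by omega
    obtain rfl : t = -1 := by omega
    rfl
  · rintro ⟨⟨p, hp⟩, ⟨q, hq⟩, hpq, rfl⟩
    simp only [Fin.mk_lt_mk] at hpq
    induction q, hpq using Nat.le_induction with
    | base => exact isRealized_simple (⟨p, by omega⟩ : Fin m)
    | succ q hpq ih =>
      have := (ih (by omega)).add (isADE_typeA m) rootsA_dotProduct ⟨q, by omega⟩ (by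
        simp only [rootsA, pairVec_dotProduct, pairVec_apply, Fin.val_castSucc, Fin.val_succ]
        split_ifs <;> omega)
      convert this using 1
      ext l
      simp only [rootsA, pairVec_apply, Pi.add_apply, Fin.val_castSucc, Fin.val_succ]
      split_ifs <;> omega

/-- The action of the nontrivial automorphism of type `A m` on `ℤ ^ (m + 1)`. -/
def negRev (m : ℕ) : (Fin (m + 1) → ℤ) →ₗ[ℤ] (Fin (m + 1) → ℤ) :=
  -LinearMap.funLeft ℤ ℤ Fin.rev

/-- Reversal of the indices alone exchanges positive and negative roots. The sign in `negRev`
compensates for this, so that `(p, q)` becomes `(m - q, m - p)`. -/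
theorem negRev_pairVec {m : ℕ} (p q : Fin (m + 1)) :
    negRev m (pairVec p q (-1)) = pairVec q.rev p.rev (-1) := by
  ext k
  simp only [negRev, LinearMap.neg_apply, Pi.neg_apply, LinearMap.funLeft_apply, pairVec_apply,
    Fin.val_rev]
  have := k.2
  have := p.2
  have := q.2
  split_ifs <;> omega

theorem negRev_rootsA {m : ℕ} (i : Fin m) :
    negRev m (rootsA m i) = rootsA m ((flipA m).1 i) := by
  rw [rootsA, negRev_pairVec, Fin.rev_succ, Fin.rev_castSucc]
  rfl

theorem flipA_mul_self (m : ℕ) : flipA m * flipA m = 1 :=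
  Subtype.ext (Equiv.ext fun i => Fin.rev_rev i)

/-- The flip replaces `p + q` by `2m - (p + q)`, so the pairs `p < q` with `p + q ≤ m` represent all
orbits, those with `p + q = m` being fixed. For given `p` there are `m - 2p` choices of `q`, and
none once `2p ≥ m`, so `p` may range over any `Fin h` with `m ≤ 2h`. -/
theorem fixedModule_typeA_equiv (R : Type*) [CommRing R] {m h : ℕ} (hm : m ≤ 2 * h) :
    Nonempty (fixedModule R (groupA m) ≃ₗ[R] ((Σ p : Fin h, Fin (m - 2 * p)) → R)) := by
  let P : (Σ p : Fin h, Fin (m - 2 * p)) → Fin (m + 1) := fun z => ⟨z.1, by have := z.2.2; omega⟩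
  let Q : (Σ p : Fin h, Fin (m - 2 * p)) → Fin (m + 1) := fun z =>
    ⟨z.1 + 1 + z.2, by have := z.2.2; omega⟩
  have hPQ : ∀ z, P z < Q z := fun z => by simp only [P, Q, Fin.mk_lt_mk]; omega
  have inj : ∀ z z', (P z : ℕ) = P z' → (Q z : ℕ) = Q z' → z = z' := by
    rintro ⟨p, j⟩ ⟨p', j'⟩ h1 h2
    obtain rfl : p = p' := Fin.ext h1
    obtain rfl : j = j' := Fin.ext (by simp only [Q] at h2; omega)
    rfl
  have rep : ∀ p q : Fin (m + 1), p < q → (p : ℕ) + q ≤ m → ∃ z, p = P z ∧ q = Q z := by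
    intro p q hpq h
    rw [Fin.lt_def] at hpq
    exact ⟨⟨⟨p, by omega⟩, ⟨q - p - 1, by simp only; omega⟩⟩, rfl,
      Fin.ext (by simp only [Q]; omega)⟩
  refine fixedModule_equiv_of_realization R rootsA_dotProduct_weightsA (flipA_mul_self m)
    (negRev m) negRev_rootsA (fun z => pairVec (P z) (Q z) (-1)) (fun z z' e => ?_)
    (fun z => isRealized_typeA.2 ⟨_, _, hPQ z, rfl⟩) (fun y hy => ?_) fun z z' e => ?_
  · obtain ⟨h1, h2, -⟩ := pairVec_inj (hPQ z) (hPQ z') (by norm_num) (by norm_num) e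
    exact inj _ _ (congrArg _ h1) (congrArg _ h2)
  · obtain ⟨p, q, hpq, rfl⟩ := isRealized_typeA.1 hy
    rcases le_total ((p : ℕ) + q) m with h | h
    · obtain ⟨z, rfl, rfl⟩ := rep p q hpq h
      exact ⟨z, Or.inl rfl⟩
    · obtain ⟨z, h1, h2⟩ := rep q.rev p.rev (Fin.rev_lt_rev.2 hpq) (by
        simp only [Fin.val_rev]; omega)
      refine ⟨z, Or.inr ?_⟩
      rw [negRev_pairVec, ← h1, ← h2, Fin.rev_rev, Fin.rev_rev]
  -- If a representative is the image of another one, both sums `p + q` are at most `m` and they add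
  -- up to `2m`. Both equal `m`, so the root is fixed and the two indices agree.
  · simp only [negRev_pairVec] at e
    obtain ⟨h1, h2, -⟩ := pairVec_inj (Fin.rev_lt_rev.2 (hPQ z)) (hPQ z') (by norm_num)
      (by norm_num) e
    have h1 := congrArg Fin.val h1
    have h2 := congrArg Fin.val h2
    have b1 := z.2.2
    have b2 := z'.2.2
    refine inj _ _ ?_ ?_ <;> simp only [P, Q, Fin.val_rev] at h1 h2 ⊢ <;> omega

theorem sum_two_mul_sub_one_sub (n : ℕ) : ∑ p : Fin n, (2 * n - 1 - 2 * (p : ℕ)) = n ^ 2 := by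
  induction n with
  | zero => simp
  | succ n ih =>
    -- Removing the largest term, at `p = 0`, and shifting the index turns the sum for `n + 1` into
    -- the sum for `n`.
    rw [Fin.sum_univ_succ]
    have : ∀ p : Fin n, 2 * (n + 1) - 1 - 2 * (p.succ : ℕ) = 2 * n - 1 - 2 * p := fun p => by
      rw [Fin.val_succ]; omega
    simp only [this, ih, Fin.val_zero]
    have : 2 * (n + 1) - 1 - 2 * 0 = 2 * n + 1 := by omega
    rw [this]
    ring

theorem sum_two_mul_sub (n : ℕ) : ∑ p : Fin n, (2 * n - 2 * (p : ℕ)) = n * (n + 1) := by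
  induction n with
  | zero => simp
  | succ n ih =>
    rw [Fin.sum_univ_succ]
    have : ∀ p : Fin n, 2 * (n + 1) - 2 * (p.succ : ℕ) = 2 * n - 2 * p := fun p => by
      rw [Fin.val_succ]; omega
    simp only [this, ih, Fin.val_zero, mul_zero, Nat.sub_zero]
    ring

end TypeA

/-! ### Type `D`: positive roots `ε_p ± ε_q` and their orbits -/

section TypeD

/-- The simple roots of type `D (n + 1)` in `ℤ ^ (n + 1)`. -/
def rootsD (n : ℕ) (i : Fin (n + 1)) : Fin (n + 1) → ℤ :=
  if h : (i : ℕ) < n then pairVec i ⟨i + 1, by omega⟩ (-1)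
  else pairVec ⟨n - 1, by omega⟩ (Fin.last n) 1

/-- Twice the fundamental weights of type `D (n + 1)`. -/
def weightsD (n : ℕ) (i k : Fin (n + 1)) : ℤ :=
  if (i : ℕ) + 1 < n then (if (k : ℕ) ≤ i then 2 else 0)
  else if (i : ℕ) < n ∧ (k : ℕ) = n then -1 else 1

theorem rootsD_dotProduct {n : ℕ} (hn : 3 ≤ n) (i j : Fin (n + 1)) :
    rootsD n i ⬝ᵥ rootsD n j = gram (typeD n) i j := by
  have hi := i.2
  have hj := j.2
  by_cases h1 : (i : ℕ) < n <;> by_cases h2 : (j : ℕ) < n <;>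
  simp only [rootsD, h1, h2, dif_pos, dif_neg, not_false_eq_true, pairVec_dotProduct,
    pairVec_apply, gram, Matrix.of_apply, typeD_apply, Fin.ext_iff, Fin.val_last, and_true,
    and_false, false_or] <;>
  split_ifs <;> omega

theorem rootsD_dotProduct_weightsD {n : ℕ} (hn : 3 ≤ n) (i j : Fin (n + 1)) :
    rootsD n i ⬝ᵥ weightsD n j = if i = j then 2 else 0 := by
  have hi := i.2
  have hj := j.2
  by_cases h1 : (i : ℕ) < n <;>
  simp only [rootsD, h1, dif_pos, dif_neg, not_false_eq_true, pairVec_dotProduct, weightsD,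
    Fin.ext_iff, Fin.val_last, and_true] <;>
  split_ifs <;> omega

/-- The action of the exchange of the ends of the fork of type `D (n + 1)` on `ℤ ^ (n + 1)`. -/
def negLast (n : ℕ) : (Fin (n + 1) → ℤ) →ₗ[ℤ] (Fin (n + 1) → ℤ) where
  toFun x k := if (k : ℕ) = n then -x k else x k
  map_add' x y := by ext k; simp only [Pi.add_apply]; split_ifs <;> ring
  map_smul' r x := by
    ext k; simp only [Pi.smul_apply, smul_eq_mul, RingHom.id_apply]; split_ifs <;> ring

theorem negLast_pairVec {n : ℕ} {p q : Fin (n + 1)} (h : p < q) (t : ℤ) :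
    negLast n (pairVec p q t) = pairVec p q (if (q : ℕ) = n then -t else t) := by
  ext k
  rw [Fin.lt_def] at h
  have := k.2
  have := q.2
  change (if (k : ℕ) = n then _ else _) = _
  simp only [pairVec_apply]
  split_ifs <;> omega

theorem flipD_val {n : ℕ} (k : Fin (n + 1)) : ((flipD n).1 k : ℕ) =
    if (k : ℕ) = n - 1 then n else if (k : ℕ) = n then n - 1 else k := by
  rw [flipD, Equiv.swap_apply_def]
  simp only [Fin.ext_iff, Fin.val_last]
  split_ifs <;> rfl

theorem negLast_rootsD {n : ℕ} (hn : 3 ≤ n) (i : Fin (n + 1)) :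
    negLast n (rootsD n i) = rootsD n ((flipD n).1 i) := by
  have hi := i.2
  have val := flipD_val i
  rw [rootsD, rootsD]
  by_cases h1 : (i : ℕ) + 1 < n
  · rw [if_neg (by omega), if_neg (by omega)] at val
    rw [dif_pos (by omega), dif_pos (by omega),
      negLast_pairVec (by rw [Fin.lt_def]; simp only; omega),
      if_neg (by simp only; omega)]
    congr 1 <;> ext <;> simp only [val]
  by_cases h2 : (i : ℕ) < n
  · rw [if_pos (by omega)] at val
    rw [dif_pos h2, dif_neg (by omega), negLast_pairVec (by rw [Fin.lt_def]; simp only; omega),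
      if_pos (by simp only; omega), neg_neg]
    congr 1 <;> ext <;> simp only [Fin.val_last] <;> omega
  · rw [if_neg (by omega), if_pos (by omega)] at val
    rw [dif_neg h2, dif_pos (by omega),
      negLast_pairVec (by rw [Fin.lt_def]; simp only [Fin.val_last]; omega),
      if_pos (by simp only [Fin.val_last])]
    congr 1 <;> ext <;> simp only [Fin.val_last] <;> omega

/-- Norm `2` leaves `±ε_p ± ε_q`, and positivity forces the sign of the first term. Conversely all
these vectors are obtained from simple roots by adding simple roots and by the graph automorphism.
-/
theorem isRealized_typeD {n : ℕ} (hn : 3 ≤ n) {x : Fin (n + 1) → ℤ} :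
    IsRealized (typeD n) (rootsD n) x ↔
      ∃ p q, p < q ∧ ∃ t : ℤ, (t = 1 ∨ t = -1) ∧ x = pairVec p q t := by
  have add := fun {x} (hx : IsRealized (typeD n) (rootsD n) x) =>
    hx.add (isADE_typeD hn) (rootsD_dotProduct hn)
  constructor
  · intro hx
    obtain ⟨p, q, hpq, s, t, hs, ht, rfl⟩ :=
      exists_pair_of_dotProduct_self (hx.dotProduct_self (rootsD_dotProduct hn))
    refine ⟨p, q, hpq, t, ht, ?_⟩
    rw [Fin.lt_def] at hpq
    have hq := q.2
    -- For `p < n - 1` the weight of index `p` gives `0 ≤ s`. For `p = n - 1` and `q = n` the two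
    -- spin weights give `0 ≤ s - t` and `0 ≤ s + t`, which exclude `s = -1`.
    have h1 := hx.dotProduct_nonneg (rootsD_dotProduct_weightsD hn) p
    have h2 := hx.dotProduct_nonneg (rootsD_dotProduct_weightsD hn) (Fin.last n)
    simp only [add_dotProduct, single_dotProduct, weightsD, Fin.val_last] at h1 h2
    obtain rfl : s = 1 := by split_ifs at h1 h2 <;> omega
    rfl
  · have minus : ∀ (p q : ℕ) (hp : p < n + 1), p < q → ∀ hq : q < n + 1,
        IsRealized (typeD n) (rootsD n) (pairVec ⟨p, hp⟩ ⟨q, hq⟩ (-1)) := by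
      intro p q hp hpq
      induction q, hpq using Nat.le_induction with
      | base =>
        intro hq
        have := isRealized_simple (M := typeD n) (a := rootsD n) ⟨p, by omega⟩
        rwa [rootsD, dif_pos (show p < n by omega)] at this
      | succ q hpq ih =>
        intro hq
        have := add (ih (by omega)) ⟨q, by omega⟩ (by
          rw [rootsD, dif_pos (show q < n by omega)]
          simp only [pairVec_dotProduct, pairVec_apply]
          split_ifs <;> omega)
        rw [rootsD, dif_pos (show q < n by omega)] at this
        convert this using 1
        ext l
        simp only [pairVec_apply, Pi.add_apply]
        split_ifs <;> omega
    -- Descending induction on `q`, with `k = n - 1 - q`. It starts from `(ε_p - ε_n) + (ε_{n-1} +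
    -- ε_n) = ε_p + ε_{n-1}`, then adds `ε_q - ε_{q+1}` to `ε_p + ε_{q+1}`.
    have plus : ∀ (k p q : ℕ) (hp : p < n + 1), q + k + 1 = n → p < q → ∀ hq : q < n + 1,
        IsRealized (typeD n) (rootsD n) (pairVec ⟨p, hp⟩ ⟨q, hq⟩ 1) := by
      intro k
      induction k with
      | zero =>
        intro p q hp hk hpq hq
        obtain rfl : q = n - 1 := by omega
        have := add (minus p n hp (by omega) (by omega)) (Fin.last n) (by
          rw [rootsD, dif_neg (by simp)]
          simp only [pairVec_dotProduct, pairVec_apply, Fin.val_last]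
          split_ifs <;> omega)
        rw [rootsD, dif_neg (by simp)] at this
        convert this using 1
        ext l
        simp only [pairVec_apply, Pi.add_apply, Fin.val_last]
        split_ifs <;> omega
      | succ k ih =>
        intro p q hp hk hpq hq
        have := add (ih p (q + 1) hp (by omega) (by omega) (by omega)) ⟨q, by omega⟩ (by
          rw [rootsD, dif_pos (show q < n by omega)]
          simp only [pairVec_dotProduct, pairVec_apply]
          split_ifs <;> omega)
        rw [rootsD, dif_pos (show q < n by omega)] at this
        convert this using 1
        ext l
        simp only [pairVec_apply, Pi.add_apply]
        split_ifs <;> omega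
    rintro ⟨⟨p, hp⟩, ⟨q, hq⟩, hpq, t, ht, rfl⟩
    simp only [Fin.mk_lt_mk] at hpq
    rcases ht with rfl | rfl
    · rcases Nat.lt_succ_iff_lt_or_eq.1 hq with h | rfl
      · exact plus (n - 1 - q) p q hp (by omega) hpq hq
      -- The remaining root `ε_p + ε_n` is the image of `ε_p - ε_n` under the exchange of the ends
      -- of the fork.
      · have := (minus p q hp hpq hq).map (negLast_rootsD hn)
        rwa [negLast_pairVec (by exact hpq), if_pos rfl, neg_neg] at this
    · exact minus p q hp hpq hq

theorem flipD_mul_self (n : ℕ) : flipD n * flipD n = 1 :=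
  Subtype.ext (Equiv.swap_mul_self _ _)

/-- The exchange changes the sign of `ε_n`. The roots `ε_i ± ε_j` with `i < j < n` are fixed and are
indexed by the off-diagonal pairs, `(i, j)` for the sign `-` and `(j, i)` for the sign `+`. The
diagonal pair `(i, i)` indexes the orbit of `ε_i - ε_n` and `ε_i + ε_n`. -/
theorem fixedModule_typeD_equiv (R : Type*) [CommRing R] {n : ℕ} (hn : 3 ≤ n) :
    Nonempty (fixedModule R (groupD n) ≃ₗ[R] (Fin n × Fin n → R)) := by
  let P : Fin n × Fin n → Fin (n + 1) := fun z => (min z.1 z.2).castSucc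
  let Q : Fin n × Fin n → Fin (n + 1) := fun z =>
    if z.1 = z.2 then Fin.last n else (max z.1 z.2).castSucc
  let t : Fin n × Fin n → ℤ := fun z => if z.2 < z.1 then 1 else -1
  have Plt : ∀ i j, i < j → P (i, j) = i.castSucc ∧ Q (i, j) = j.castSucc ∧ t (i, j) = -1 :=
    fun i j h => by simp [P, Q, t, h.le, h.ne, not_lt_of_gt h]
  have Pgt : ∀ i j, j < i → P (i, j) = j.castSucc ∧ Q (i, j) = i.castSucc ∧ t (i, j) = 1 :=
    fun i j h => by simp [P, Q, t, h, h.le, h.ne']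
  have Peq : ∀ i, P (i, i) = i.castSucc ∧ Q (i, i) = Fin.last n ∧ t (i, i) = -1 :=
    fun i => by simp [P, Q, t]
  have cases : ∀ z : Fin n × Fin n, (z.1 < z.2 ∧ (P z : ℕ) = z.1 ∧ (Q z : ℕ) = z.2 ∧ t z = -1) ∨
      (z.2 < z.1 ∧ (P z : ℕ) = z.2 ∧ (Q z : ℕ) = z.1 ∧ t z = 1) ∨
      (z.1 = z.2 ∧ (P z : ℕ) = z.1 ∧ (Q z : ℕ) = n ∧ t z = -1) := by
    rintro ⟨i, j⟩
    rcases lt_trichotomy i j with h | rfl | h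
    · simp [h, Plt i j h]
    · simp [Peq i]
    · simp [h, Pgt i j h]
  have hPQ : ∀ z, P z < Q z := fun z => by
    have := z.1.2
    rw [Fin.lt_def]
    have := cases z
    simp only [Fin.lt_def, Fin.ext_iff] at this
    omega
  have ht : ∀ z, t z = 1 ∨ t z = -1 := fun z => by
    have := cases z
    omega
  have ht0 : ∀ z, t z ≠ 0 := fun z => by
    have := ht z
    omega
  have inj : ∀ z z', P z = P z' → Q z = Q z' → t z = t z' → z = z' := by
    intro z z' h1 h2 h3
    have c := cases z
    have c' := cases z'
    have := z.1.2
    have := z.2.2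
    have := z'.1.2
    have := z'.2.2
    rw [Prod.ext_iff]
    simp only [Fin.ext_iff, Fin.lt_def] at *
    omega
  refine fixedModule_equiv_of_realization R (rootsD_dotProduct_weightsD hn) (flipD_mul_self n)
    (negLast n) (negLast_rootsD hn) (fun z => pairVec (P z) (Q z) (t z)) (fun z z' e => ?_)
    (fun z => (isRealized_typeD hn).2 ⟨_, _, hPQ z, _, ht z, rfl⟩) (fun y hy => ?_) fun z z' e => ?_
  · obtain ⟨h1, h2, h3⟩ := pairVec_inj (hPQ z) (hPQ z') (ht0 z) (ht0 z') e
    exact inj _ _ h1 h2 h3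
  · obtain ⟨p, q, hpq, s, hs, rfl⟩ := (isRealized_typeD hn).1 hy
    obtain ⟨i, rfl⟩ := Fin.exists_castSucc_eq.2 (hpq.trans_le (Fin.le_last q)).ne
    rcases Fin.eq_castSucc_or_eq_last q with ⟨j, rfl⟩ | rfl
    · rw [Fin.castSucc_lt_castSucc_iff] at hpq
      rcases hs with rfl | rfl
      · refine ⟨(j, i), Or.inl ?_⟩
        rw [(Pgt j i hpq).1, (Pgt j i hpq).2.1, (Pgt j i hpq).2.2]
      · refine ⟨(i, j), Or.inl ?_⟩
        rw [(Plt i j hpq).1, (Plt i j hpq).2.1, (Plt i j hpq).2.2]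
    · refine ⟨(i, i), ?_⟩
      rw [(Peq i).1, (Peq i).2.1, (Peq i).2.2, negLast_pairVec hpq, if_pos (Fin.val_last n),
        neg_neg]
      exact hs.symm.imp (fun h => by rw [h]) fun h => by rw [h]
  · simp only [negLast_pairVec (hPQ z)] at e
    have hc : (if (Q z : ℕ) = n then -t z else t z) ≠ 0 := by
      have := ht0 z
      split_ifs <;> omega
    obtain ⟨h1, h2, h3⟩ := pairVec_inj (hPQ z) (hPQ z') hc (ht0 z') e
    refine inj _ _ h1 h2 ?_
    -- If `Q z' = n`, both indices are diagonal and both signs are `-1` by the choice of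
    -- representatives. Otherwise `h3` is the required equality.
    rw [h2] at h3
    have c := cases z'
    have d := cases z
    have := z'.1.2
    have := z'.2.2
    have := z.1.2
    have := z.2.2
    simp only [Fin.ext_iff] at h1 h2
    split_ifs at h3 <;> omega

end TypeD

/-! ### Freeness and ranks of the three fixed modules -/

section Ranks

variable (R : Type*) [CommRing R]

theorem free_fixedModule_typeA_odd (n : ℕ) : Module.Free R (fixedModule R (groupA (2 * n - 1))) :=
  have ⟨e⟩ := fixedModule_typeA_equiv R (show 2 * n - 1 ≤ 2 * n by omega)
  .of_equiv e.symm

theorem free_fixedModule_typeA_even (n : ℕ) : Module.Free R (fixedModule R (groupA (2 * n))) :=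
  have ⟨e⟩ := fixedModule_typeA_equiv R (le_refl (2 * n))
  .of_equiv e.symm

theorem free_fixedModule_typeD {n : ℕ} (hn : 3 ≤ n) : Module.Free R (fixedModule R (groupD n)) :=
  have ⟨e⟩ := fixedModule_typeD_equiv R hn
  .of_equiv e.symm

variable [Nontrivial R]

theorem finrank_fixedModule_typeA_odd (n : ℕ) :
    Module.finrank R (fixedModule R (groupA (2 * n - 1))) = n ^ 2 := by
  obtain ⟨e⟩ := fixedModule_typeA_equiv R (show 2 * n - 1 ≤ 2 * n by omega)
  rw [e.finrank_eq, Module.finrank_fintype_fun_eq_card, Fintype.card_sigma]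
  simp only [Fintype.card_fin]
  exact sum_two_mul_sub_one_sub n

theorem finrank_fixedModule_typeA_even (n : ℕ) :
    Module.finrank R (fixedModule R (groupA (2 * n))) = n * (n + 1) := by
  obtain ⟨e⟩ := fixedModule_typeA_equiv R (le_refl (2 * n))
  rw [e.finrank_eq, Module.finrank_fintype_fun_eq_card, Fintype.card_sigma]
  simp only [Fintype.card_fin]
  exact sum_two_mul_sub n

theorem finrank_fixedModule_typeD {n : ℕ} (hn : 3 ≤ n) :
    Module.finrank R (fixedModule R (groupD n)) = n ^ 2 := by
  obtain ⟨e⟩ := fixedModule_typeD_equiv R hn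
  rw [e.finrank_eq, Module.finrank_fintype_fun_eq_card, Fintype.card_prod, Fintype.card_fin, sq]

end Ranks

end LawrenceKrammer

/-! ### The main theorem -/

open LawrenceKrammer in
theorem mainTheorem3 :
    (∀ p q r : ℤ, 2 * r ≠ p + q →
      ∃ S : Finset ℕ, S.card ≤ 2 ∧
        (¬ ((r < 0 ∧ 0 < p + q) ∨ (p + q < 0 ∧ 0 < r)) → S = ∅) ∧
        ∀ (n : ℕ) (hn : 3 ≤ n), n ∉ S →
          ∀ (F₁ : LKFamilyGr (CoxeterMatrix.A (2 * n - 1)) (yParam p q r))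
            (F₃ : LKFamilyGr (typeD n) (yParam p q r)),
            ¬ Nonempty ((twistedAodd n F₁).Equiv (twistedD hn F₃))) ∧
    (∀ (R : Type*) [CommRing R] [Nontrivial R] (n : ℕ) (hn : 3 ≤ n),
      (Module.Free R (fixedModule R (groupA (2 * n - 1))) ∧
        Module.finrank R (fixedModule R (groupA (2 * n - 1))) = n ^ 2) ∧
      (Module.Free R (fixedModule R (groupA (2 * n))) ∧
        Module.finrank R (fixedModule R (groupA (2 * n))) = n * (n + 1)) ∧
      (Module.Free R (fixedModule R (groupD n)) ∧
        Module.finrank R (fixedModule R (groupD n)) = n ^ 2) ∧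
      ∀ (P : Param R) (F₁ : LKFamilyGr (CoxeterMatrix.A (2 * n - 1)) P)
        (F₂ : LKFamilyGr (CoxeterMatrix.A (2 * n)) P) (F₃ : LKFamilyGr (typeD n) P),
        ¬ Nonempty ((twistedAeven n F₂).Equiv (twistedAodd n F₁)) ∧
        ¬ Nonempty ((twistedAeven n F₂).Equiv (twistedD hn F₃))) := by
  -- The empty set serves for all `p`, `q`, `r`: the argument through `a² ≠ 0` applies to every `n ≥
  -- 3`.
  refine ⟨fun p q r h => ⟨∅, by simp, fun _ => rfl, fun n hn _ F₁ F₃ => ?_⟩,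
    fun R _ _ n hn => ⟨⟨free_fixedModule_typeA_odd R n, finrank_fixedModule_typeA_odd R n⟩,
      ⟨free_fixedModule_typeA_even R n, finrank_fixedModule_typeA_even R n⟩,
      ⟨free_fixedModule_typeD R hn, finrank_fixedModule_typeD R hn⟩,
      fun P F₁ F₂ F₃ => ⟨?_, ?_⟩⟩⟩
  · have ha := yParam_a_ne_zero h
    exact not_equiv_twistedAodd_twistedD hn (mul_ne_zero ha ha) F₁ F₃
  · rintro ⟨E⟩
    have := E.toLinearEquiv.finrank_eq
    rw [finrank_fixedModule_typeA_odd, finrank_fixedModule_typeA_even] at this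
    -- `n(n + 1) = n²` would force `n = 0`.
    nlinarith
  · rintro ⟨E⟩
    have := E.toLinearEquiv.finrank_eq
    rw [finrank_fixedModule_typeD R hn, finrank_fixedModule_typeA_even] at this
    nlinarith
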